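/- For real $\nu\ge 0$ let $J_\nu$ and $I_\nu$ be the Bessel and the modified Bessel functions of the first kind, and let $j_{\nu,1}$ be the smallest positive zero of $J_\nu$ (it exists for every $\nu=0,1,2,\dots$). For $m=0,1,2,\dots$ and real $\Lambda$ put $$\sigma^{(\Lambda)}_{(m)}=\begin{cases}\dfrac{\sqrt{-\Lambda}\,I_m'(\sqrt{-\Lambda})}{I_m(\sqrt{-\Lambda})},&\Lambda<0,\\[2mm] m,&\Lambda=0,\\[1mm] \dfrac{\sqrt{\Lambda}\,J_m'(\sqrt{\Lambda})}{J_m(\sqrt{\Lambda})},&\Lambda>0,\ J_m(\sqrt\Lambda)\neq 0.\end{cases}$$ Let $\mathbb D$ be the open unit disk in $\mathbb R^2$. The Dirichlet-to-Neumann operator $\mathcal D_\Lambda$ of $\mathbb D$ maps the boundary trace $u=U|_{\partial\mathbb D}$ of a function $U\in H^1(\mathbb D)$ with $-\Delta U=\Lambda U$ in $\mathbb D$ to its outer normal derivative $\partial_nU$ (in the weak sense). Let $\sigma_1^{(\Lambda)}\le\sigma_2^{(\Lambda)}\le\dots\to+\infty$ be its eigenvalues in non-decreasing order, repeated according to multiplicity.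 **Theorem.** 1. Let $n<m$ be non-negative integers. For every real $\Lambda<j_{n,1}^2$, both $\sigma^{(\Lambda)}_{(n)}$ and $\sigma^{(\Lambda)}_{(m)}$ are defined and $\sigma^{(\Lambda)}_{(n)}\ne\sigma^{(\Lambda)}_{(m)}$. 2. For every real $\Lambda<j_{0,1}^2$, $$\sigma_k^{(\Lambda)}=\sigma^{(\Lambda)}_{(\lfloor k/2\rfloor)},\qquad k=1,2,3,\dots$$ 3. For every fixed $z>0$, the function $\nu\mapsto zI_\nu'(z)/I_\nu(z)$ is strictly increasing on $[0,\infty)$, and the function $\nu\mapsto zJ_\nu'(z)/J_\nu(z)$ is strictly increasing on every interval of orders $\nu\ge 0$ on which $J_\nu(z)\ne 0$. -/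

import Mathlib

open MeasureTheory Filter Topology Set
open scoped ContDiff

noncomputable section

namespace DiskDtN

/-! ### Bessel functions and the eigenvalue curves of the disk -/

/-- The Bessel function of the first kind `J_ν(x)` of real order, for `x > 0`. -/
def besselJ (ν x : ℝ) : ℝ :=
  ∑' k : ℕ, (-1 : ℝ) ^ k / ((k.factorial : ℝ) * Real.Gamma ((k : ℝ) + ν + 1)) *
    (x / 2) ^ (2 * (k : ℝ) + ν)

/-- The modified Bessel function of the first kind `I_ν(x)` of real order, for `x > 0`. -/
def besselI (ν x : ℝ) : ℝ :=
  ∑' k : ℕ, 1 / ((k.factorial : ℝ) * Real.Gamma ((k : ℝ) + ν + 1)) *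
    (x / 2) ^ (2 * (k : ℝ) + ν)

/-- The first positive zero `j_{ν,1}` of `J_ν`. -/
def besselJZero (ν : ℝ) : ℝ :=
  sInf {x : ℝ | 0 < x ∧ besselJ ν x = 0}

/-- The logarithmic derivative `z I_ν'(z) / I_ν(z)`. -/
def logDerivI (ν z : ℝ) : ℝ :=
  z * deriv (besselI ν) z / besselI ν z

/-- The logarithmic derivative `z J_ν'(z) / J_ν(z)`, where `J_ν(z) ≠ 0`. -/
def logDerivJ (ν z : ℝ) : ℝ :=
  z * deriv (besselJ ν) z / besselJ ν z

/-- The eigenvalue curve `σ_{(m)}^{(Λ)}` of the unit disk. -/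
def sigmaCurve (Λ : ℝ) (m : ℕ) : ℝ :=
  if Λ < 0 then logDerivI m (√(-Λ))
  else if Λ = 0 then (m : ℝ)
  else logDerivJ m (√Λ)

/-! ### The Dirichlet-to-Neumann operator of the unit disk

The plane is `ℂ`, with its Euclidean norm and Lebesgue measure. -/

/-- Lebesgue measure on the open unit disk. -/
def diskMeasure : Measure ℂ :=
  volume.restrict (Metric.ball (0 : ℂ) 1)

/-- Arc length on the unit circle, as a measure on the plane. -/
def circleMeasure : Measure ℂ :=
  (volume.restrict (Ioc (-Real.pi) Real.pi)).map (circleMap 0 1)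

/-- The space `L²` of the unit circle, with complex values. -/
abbrev L2Circle : Type :=
  Lp ℂ 2 circleMeasure

/-- The partial derivatives `∂φ/∂x` (for `i = 0`) and `∂φ/∂y` (for `i = 1`). -/
def pderiv (i : Fin 2) (φ : ℂ → ℂ) (z : ℂ) : ℂ :=
  fderiv ℝ φ z (![1, Complex.I] i)

/-- Smooth functions with compact support in the open unit disk. -/
structure IsTestFunction (φ : ℂ → ℂ) : Prop where
  smooth : ContDiff ℝ ∞ φ
  compact : HasCompactSupport φ
  support : tsupport φ ⊆ Metric.ball (0 : ℂ) 1

/-- `U` belongs to the Sobolev space `H¹` of the disk, with weak gradient `G = (G 0, G 1)`. -/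
structure IsH1 (U : ℂ → ℂ) (G : Fin 2 → ℂ → ℂ) : Prop where
  memLp : MemLp U 2 diskMeasure
  memLp_grad : ∀ i, MemLp (G i) 2 diskMeasure
  weak : ∀ φ : ℂ → ℂ, IsTestFunction φ → ∀ i,
    ∫ z, U z * pderiv i φ z ∂diskMeasure = -∫ z, G i z * φ z ∂diskMeasure

/-- The boundary trace of the `H¹` function `U` (with gradient `G`) is `u`: the trace is the
extension by continuity of `φ ↦ φ|_{∂𝔻}` from smooth functions on the closed disk, so that `u` is
the limit in `L²(∂𝔻)` of the boundary values of smooth functions converging to `U` in `H¹`. -/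
def HasTrace (U : ℂ → ℂ) (G : Fin 2 → ℂ → ℂ) (u : L2Circle) : Prop :=
  ∃ φ : ℕ → ℂ → ℂ, (∀ k, ContDiff ℝ ∞ (φ k)) ∧
    Tendsto (fun k => eLpNorm (φ k - U) 2 diskMeasure) atTop (𝓝 0) ∧
    (∀ i, Tendsto (fun k => eLpNorm (pderiv i (φ k) - G i) 2 diskMeasure) atTop (𝓝 0)) ∧
    Tendsto (fun k => eLpNorm (φ k - (u : ℂ → ℂ)) 2 circleMeasure) atTop (𝓝 0)

/-- The bilinear form `∫_𝔻 ∇U · ∇V - Λ ∫_𝔻 U V`, in terms of `U`, `V` and their gradients. -/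
def energy (Λ : ℝ) (U : ℂ → ℂ) (G : Fin 2 → ℂ → ℂ) (V : ℂ → ℂ) (H : Fin 2 → ℂ → ℂ) : ℂ :=
  (∑ i, ∫ z, G i z * H i z ∂diskMeasure) - (Λ : ℂ) * ∫ z, U z * V z ∂diskMeasure

/-- `-ΔU = Λ U` in the disk, in the sense of distributions. -/
def IsHelmholtz (Λ : ℝ) (U : ℂ → ℂ) (G : Fin 2 → ℂ → ℂ) : Prop :=
  ∀ φ : ℂ → ℂ, IsTestFunction φ → energy Λ U G φ (fun i => pderiv i φ) = 0

/-- The outer normal derivative of a solution `U` of `-ΔU = Λ U` is `g`, in the weak sense given by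
the first Green formula tested against `H¹`. -/
def HasNormalDeriv (Λ : ℝ) (U : ℂ → ℂ) (G : Fin 2 → ℂ → ℂ) (g : L2Circle) : Prop :=
  ∀ (V : ℂ → ℂ) (H : Fin 2 → ℂ → ℂ) (v : L2Circle), IsH1 V H → HasTrace V H v →
    energy Λ U G V H = ∫ z, g z * v z ∂circleMeasure

/-- `g = D_Λ u`: the function `u` is the boundary trace, and `g` the normal derivative, of a
function in `H¹` that solves `-ΔU = Λ U` in the disk. -/
def IsDtN (Λ : ℝ) (u g : L2Circle) : Prop :=
  ∃ (U : ℂ → ℂ) (G : Fin 2 → ℂ → ℂ), IsH1 U G ∧ HasTrace U G u ∧ IsHelmholtz Λ U G ∧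
    HasNormalDeriv Λ U G g

/-! ### Linearity -/

theorem IsTestFunction.memLp {φ : ℂ → ℂ} (h : IsTestFunction φ) : MemLp φ 2 diskMeasure :=
  (h.smooth.continuous.memLp_of_hasCompactSupport h.compact).mono_measure Measure.restrict_le_self

theorem continuous_pderiv {φ : ℂ → ℂ} (h : ContDiff ℝ ∞ φ) (i : Fin 2) :
    Continuous (pderiv i φ) :=
  (h.continuous_fderiv (by simp)).clm_apply continuous_const

theorem IsTestFunction.memLp_pderiv {φ : ℂ → ℂ} (h : IsTestFunction φ) (i : Fin 2) :
    MemLp (pderiv i φ) 2 diskMeasure :=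
  ((continuous_pderiv h.smooth i).memLp_of_hasCompactSupport
    (h.compact.fderiv_apply ℝ _)).mono_measure Measure.restrict_le_self

theorem pderiv_add {φ ψ : ℂ → ℂ} (h : ContDiff ℝ ∞ φ) (h' : ContDiff ℝ ∞ ψ) (i : Fin 2) :
    pderiv i (φ + ψ) = pderiv i φ + pderiv i ψ := by
  funext z
  simp [pderiv, fderiv_add ((h.differentiable (by simp)) z) ((h'.differentiable (by simp)) z)]

theorem pderiv_smul {φ : ℂ → ℂ} (h : ContDiff ℝ ∞ φ) (c : ℂ) (i : Fin 2) :
    pderiv i (c • φ) = c • pderiv i φ := by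
  funext z
  simp [pderiv, fderiv_const_smul ((h.differentiable (by simp)) z) c]

theorem tendsto_eLpNorm_add {μ : Measure ℂ} {f f' : ℕ → ℂ → ℂ} {g g' : ℂ → ℂ}
    (hf : ∀ k, AEStronglyMeasurable (f k) μ) (hf' : ∀ k, AEStronglyMeasurable (f' k) μ)
    (hg : AEStronglyMeasurable g μ) (hg' : AEStronglyMeasurable g' μ)
    (h : Tendsto (fun k => eLpNorm (f k - g) 2 μ) atTop (𝓝 0))
    (h' : Tendsto (fun k => eLpNorm (f' k - g') 2 μ) atTop (𝓝 0)) :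
    Tendsto (fun k => eLpNorm (f k + f' k - (g + g')) 2 μ) atTop (𝓝 0) := by
  refine tendsto_of_tendsto_of_tendsto_of_le_of_le tendsto_const_nhds
    (by simpa using h.add h') (fun _ => zero_le) fun k => ?_
  have e : f k + f' k - (g + g') = (f k - g) + (f' k - g') := by abel
  simp only [e]
  exact eLpNorm_add_le ((hf k).sub hg) ((hf' k).sub hg') (by norm_num)

theorem tendsto_eLpNorm_smul {μ : Measure ℂ} {f : ℕ → ℂ → ℂ} {g : ℂ → ℂ} (c : ℂ)
    (h : Tendsto (fun k => eLpNorm (f k - g) 2 μ) atTop (𝓝 0)) :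
    Tendsto (fun k => eLpNorm (c • f k - c • g) 2 μ) atTop (𝓝 0) := by
  have e : ∀ k, eLpNorm (c • f k - c • g) 2 μ = ‖c‖ₑ * eLpNorm (f k - g) 2 μ := fun k => by
    rw [← smul_sub, eLpNorm_const_smul]
  simp only [e]
  simpa using ENNReal.Tendsto.const_mul h (Or.inr (by simp))

theorem integral_add_mul {μ : Measure ℂ} {f f' g : ℂ → ℂ} (hf : MemLp f 2 μ)
    (hf' : MemLp f' 2 μ) (hg : MemLp g 2 μ) :
    ∫ z, (f z + f' z) * g z ∂μ = (∫ z, f z * g z ∂μ) + ∫ z, f' z * g z ∂μ := by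
  simp only [add_mul]
  exact integral_add (hf.integrable_mul hg) (hf'.integrable_mul hg)

theorem IsH1.add {U U' : ℂ → ℂ} {G G' : Fin 2 → ℂ → ℂ} (h : IsH1 U G) (h' : IsH1 U' G') :
    IsH1 (U + U') (G + G') where
  memLp := h.memLp.add h'.memLp
  memLp_grad i := (h.memLp_grad i).add (h'.memLp_grad i)
  weak φ hφ i := by
    simp only [Pi.add_apply]
    rw [integral_add_mul h.memLp h'.memLp (hφ.memLp_pderiv i),
      integral_add_mul (h.memLp_grad i) (h'.memLp_grad i) hφ.memLp, h.weak φ hφ i,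
      h'.weak φ hφ i]
    ring

theorem IsH1.smul {U : ℂ → ℂ} {G : Fin 2 → ℂ → ℂ} (h : IsH1 U G) (c : ℂ) :
    IsH1 (c • U) (c • G) where
  memLp := h.memLp.const_smul c
  memLp_grad i := (h.memLp_grad i).const_smul c
  weak φ hφ i := by
    simp only [Pi.smul_apply, smul_eq_mul, mul_assoc, integral_const_mul, h.weak φ hφ i, mul_neg]

theorem HasTrace.add {U U' : ℂ → ℂ} {G G' : Fin 2 → ℂ → ℂ} {u u' : L2Circle}
    (hU : IsH1 U G) (hU' : IsH1 U' G') (h : HasTrace U G u) (h' : HasTrace U' G' u') :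
    HasTrace (U + U') (G + G') (u + u') := by
  obtain ⟨φ, s, a, b, d⟩ := h
  obtain ⟨φ', s', a', b', d'⟩ := h'
  refine ⟨fun k => φ k + φ' k, fun k => (s k).add (s' k), ?_, fun i => ?_, ?_⟩
  · exact tendsto_eLpNorm_add (fun k => (s k).continuous.aestronglyMeasurable)
      (fun k => (s' k).continuous.aestronglyMeasurable) hU.memLp.1 hU'.memLp.1 a a'
  · simp only [pderiv_add (s _) (s' _)]
    exact tendsto_eLpNorm_add (fun k => (continuous_pderiv (s k) i).aestronglyMeasurable)
      (fun k => (continuous_pderiv (s' k) i).aestronglyMeasurable)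
      (hU.memLp_grad i).1 (hU'.memLp_grad i).1 (b i) (b' i)
  · refine (tendsto_eLpNorm_add (fun k => (s k).continuous.aestronglyMeasurable)
      (fun k => (s' k).continuous.aestronglyMeasurable) (Lp.aestronglyMeasurable u)
      (Lp.aestronglyMeasurable u') d d').congr fun k => eLpNorm_congr_ae ?_
    filter_upwards [Lp.coeFn_add u u'] with z hz
    simp only [Pi.sub_apply, Pi.add_apply, hz]

theorem HasTrace.smul {U : ℂ → ℂ} {G : Fin 2 → ℂ → ℂ} {u : L2Circle}
    (h : HasTrace U G u) (c : ℂ) : HasTrace (c • U) (c • G) (c • u) := by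
  obtain ⟨φ, s, a, b, d⟩ := h
  refine ⟨fun k => c • φ k, fun k => (s k).const_smul c, tendsto_eLpNorm_smul c a, fun i => ?_, ?_⟩
  · simp only [pderiv_smul (s _)]
    exact tendsto_eLpNorm_smul c (b i)
  · refine (tendsto_eLpNorm_smul c d).congr fun k => eLpNorm_congr_ae ?_
    filter_upwards [Lp.coeFn_smul c u] with z hz
    simp only [Pi.sub_apply, Pi.smul_apply, hz]

theorem energy_add {Λ : ℝ} {U U' V : ℂ → ℂ} {G G' H : Fin 2 → ℂ → ℂ} (hU : IsH1 U G)
    (hU' : IsH1 U' G') (hV : MemLp V 2 diskMeasure) (hH : ∀ i, MemLp (H i) 2 diskMeasure) :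
    energy Λ (U + U') (G + G') V H = energy Λ U G V H + energy Λ U' G' V H := by
  simp only [energy, Pi.add_apply, integral_add_mul hU.memLp hU'.memLp hV,
    fun i => integral_add_mul (hU.memLp_grad i) (hU'.memLp_grad i) (hH i),
    Finset.sum_add_distrib]
  ring

theorem energy_smul {Λ : ℝ} {U V : ℂ → ℂ} {G H : Fin 2 → ℂ → ℂ} (c : ℂ) :
    energy Λ (c • U) (c • G) V H = c * energy Λ U G V H := by
  simp only [energy, Pi.smul_apply, smul_eq_mul, mul_assoc, integral_const_mul, mul_sub,
    Finset.mul_sum]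
  ring

theorem isDtN_zero (Λ : ℝ) : IsDtN Λ 0 0 := by
  refine ⟨0, 0, ⟨MemLp.zero, fun _ => MemLp.zero, by simp⟩, ⟨0, fun _ => contDiff_const, by simp,
    fun i => ?_, ?_⟩, fun φ _ => by simp [energy], fun V H v _ _ => ?_⟩
  · have e : pderiv i (0 : ℂ → ℂ) = 0 := by funext z; simp [pderiv]
    simp [e]
  · have e : eLpNorm ((0 : ℂ → ℂ) - ((0 : L2Circle) : ℂ → ℂ)) 2 circleMeasure = 0 := by
      rw [eLpNorm_congr_ae (g := 0), eLpNorm_zero]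
      filter_upwards [Lp.coeFn_zero ℂ 2 circleMeasure] with z hz
      simp only [Pi.sub_apply, Pi.zero_apply, hz, sub_zero]
    simp only [Pi.zero_apply, e, tendsto_const_nhds]
  · rw [integral_eq_zero_of_ae]
    · simp [energy]
    · filter_upwards [Lp.coeFn_zero ℂ 2 circleMeasure] with z hz
      simp only [Pi.zero_apply, hz, zero_mul]

theorem IsDtN.add {Λ : ℝ} {u g u' g' : L2Circle} (h : IsDtN Λ u g) (h' : IsDtN Λ u' g') :
    IsDtN Λ (u + u') (g + g') := by
  obtain ⟨U, G, a, b, c, d⟩ := h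
  obtain ⟨U', G', a', b', c', d'⟩ := h'
  refine ⟨U + U', G + G', a.add a', b.add a a' b', fun φ hφ => ?_, fun V H v hV hv => ?_⟩
  · rw [energy_add a a' hφ.memLp hφ.memLp_pderiv, c φ hφ, c' φ hφ, add_zero]
  · rw [energy_add a a' hV.memLp hV.memLp_grad, d V H v hV hv, d' V H v hV hv,
      ← integral_add_mul (Lp.memLp g) (Lp.memLp g') (Lp.memLp v)]
    refine integral_congr_ae ?_
    filter_upwards [Lp.coeFn_add g g'] with z hz
    rw [hz, Pi.add_apply]

theorem IsDtN.smul {Λ : ℝ} {u g : L2Circle} (c : ℂ) (h : IsDtN Λ u g) :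
    IsDtN Λ (c • u) (c • g) := by
  obtain ⟨U, G, a, b, e, d⟩ := h
  refine ⟨c • U, c • G, a.smul c, b.smul c, fun φ hφ => ?_, fun V H v hV hv => ?_⟩
  · rw [energy_smul, e φ hφ, mul_zero]
  · rw [energy_smul, d V H v hV hv, ← integral_const_mul]
    refine integral_congr_ae ?_
    filter_upwards [Lp.coeFn_smul c g] with z hz
    rw [hz, Pi.smul_apply, smul_eq_mul, mul_assoc]

/-! ### Eigenvalues of the Dirichlet-to-Neumann operator -/

/-- The eigenspace `{u : D_Λ u = t u}`. -/
def dtnEigenspace (Λ t : ℝ) : Submodule ℂ L2Circle where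
  carrier := {u | IsDtN Λ u ((t : ℂ) • u)}
  zero_mem' := by
    rw [mem_ofPred_eq, smul_zero]
    exact isDtN_zero Λ
  add_mem' h h' := by
    rw [mem_ofPred_eq, smul_add]
    exact IsDtN.add h h'
  smul_mem' c u h := by
    have := IsDtN.smul c h
    rwa [smul_comm] at this

/-- `σ 1 ≤ σ 2 ≤ ⋯ → +∞` is the sequence of the eigenvalues of `D_Λ` in non-decreasing order,
each repeated according to its multiplicity. -/
structure IsEigenvalueSequence (Λ : ℝ) (σ : ℕ+ → ℝ) : Prop where
  mono : Monotone σ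
  tendsto : Tendsto σ atTop atTop
  finite : ∀ t : ℝ, FiniteDimensional ℂ (dtnEigenspace Λ t)
  mult : ∀ t : ℝ, Module.finrank ℂ (dtnEigenspace Λ t) = Nat.card {k : ℕ+ // σ k = t}

end DiskDtN

end

/-! All three branches of the eigenvalue curve come from one entire function F_ν(t) = `besselSeries
ν t`. It satisfies F_ν' = F_{ν+1} and F_ν = (ν+1) F_{ν+1} + t F_{ν+2}, which together are Bessel's
equation. With c = -Λ/4, σ_(m) is L_m(c), where L_ν(t) = ν + 2t F_{ν+1}(t)/F_ν(t).

The orders are compared by a Wronskian (`wronskian_eq`). For the radial solutions r^ν F_ν(c r²) and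
r^μ F_μ(c r²) it gives L_μ(c) - L_ν(c) as (μ² - ν²)/2 times a weighted integral of F_ν F_μ, divided
by F_ν(c) F_μ(c). Below the first zero of F_ν everything is positive, because a Sturm argument
(`besselSeries_pos_of_lt_order`) carries positivity to all higher orders; hence the curves are
strictly ordered. Beyond the first zero the product F_ν F_μ may change sign. There the same
identity, divided by μ - ν, is passed to the limit μ → ν. The derivative of L_ν(c) in ν is then ν ∫
s^(ν-1) F_ν(cs)² ds / F_ν(c)² > 0 (`hasDerivAt_logDerivSeries_order`).

For the operator, F_{|n|}(c|z|²) times z^n or a power of the conjugate of z is a smooth solution, so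
e^{inθ} is an eigenfunction with eigenvalue σ_(|n|). Green's formula makes the operator symmetric.
As the e^{inθ} are complete in L², an eigenspace is spanned by the modes it contains, and its
dimension is the number of n with σ_(|n|) = t. Since σ_(m) increases strictly to infinity, the order
of frequencies 0, 1, -1, 2, -2, … sorts the spectrum. A nondecreasing sequence tending to infinity
is determined by the multiplicities of its values (`eq_of_card_fiber_eq`). -/

namespace DiskDtN

/-! ### The entire function behind the Bessel functions -/

/-- The entire function `t ↦ ∑ tᵏ / (k! Γ(k + ν + 1))`: one has
`J_ν(x) = (x/2)^ν F_ν(-x²/4)` and `I_ν(x) = (x/2)^ν F_ν(x²/4)`. -/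
noncomputable def besselSeries (ν t : ℝ) : ℝ :=
  ∑' k : ℕ, t ^ k / ((k.factorial : ℝ) * Real.Gamma ((k : ℝ) + ν + 1))

/-- Γ increases on [2, ∞) from the value 1, and Γ(s) = Γ(s+1)/s covers [1, 2]. The bound does not
depend on ν, so the series has the majorant 2|t|^k/k! for all orders ν ≥ 0 at once. Convergence,
termwise differentiation and continuity in the order all rest on it. -/
theorem half_le_Gamma {s : ℝ} (hs : 1 ≤ s) : 1 / 2 ≤ Real.Gamma s := by
  have two : ∀ u : ℝ, 2 ≤ u → 1 ≤ Real.Gamma u := fun u hu => by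
    rw [← Real.Gamma_two]
    exact Real.Gamma_strictMonoOn_Ici.monotoneOn (mem_Ici.2 le_rfl) (mem_Ici.2 hu) hu
  rcases le_total 2 s with h | h
  · linarith [two s h]
  · have h1 := two (s + 1) (by linarith)
    rw [Real.Gamma_add_one (by linarith)] at h1
    have h2 : 0 < Real.Gamma s := Real.Gamma_pos_of_pos (by linarith)
    nlinarith

theorem half_le_Gamma_index {ν : ℝ} (hν : 0 ≤ ν) (k : ℕ) :
    1 / 2 ≤ Real.Gamma ((k : ℝ) + ν + 1) :=
  half_le_Gamma (by linarith [(Nat.cast_nonneg k : (0 : ℝ) ≤ k)])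

theorem norm_besselSeries_term_le {ν : ℝ} (hν : 0 ≤ ν) (t : ℝ) (k : ℕ) :
    ‖t ^ k / ((k.factorial : ℝ) * Real.Gamma ((k : ℝ) + ν + 1))‖ ≤ 2 * (|t| ^ k / k.factorial) := by
  have hG := half_le_Gamma_index hν k
  have hk : (0 : ℝ) < k.factorial := by positivity
  rw [norm_div, norm_mul, norm_pow, Real.norm_eq_abs, Real.norm_of_nonneg hk.le,
    Real.norm_of_nonneg (by linarith), ← mul_div_assoc, div_le_div_iff₀ (by positivity) hk]
  have : 0 ≤ |t| ^ k * k.factorial := by positivity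
  nlinarith

theorem summable_besselSeries {ν : ℝ} (hν : 0 ≤ ν) (t : ℝ) :
    Summable fun k : ℕ => t ^ k / ((k.factorial : ℝ) * Real.Gamma ((k : ℝ) + ν + 1)) :=
  Summable.of_norm_bounded ((Real.summable_pow_div_factorial |t|).mul_left 2)
    (norm_besselSeries_term_le hν t)

theorem abs_besselSeries_le {ν : ℝ} (hν : 0 ≤ ν) (t : ℝ) :
    |besselSeries ν t| ≤ 2 * Real.exp |t| := by
  have h := tsum_of_norm_bounded
    ((NormedSpace.expSeries_div_hasSum_exp |t|).mul_left 2) (norm_besselSeries_term_le hν t)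
  rwa [← congrFun Real.exp_eq_exp_ℝ |t|] at h

theorem besselSeries_pos {ν t : ℝ} (hν : 0 ≤ ν) (ht : 0 ≤ t) : 0 < besselSeries ν t := by
  refine (summable_besselSeries hν t).tsum_pos (fun k => ?_) 0 ?_
  · have := half_le_Gamma_index hν k
    positivity
  · have := half_le_Gamma_index hν 0
    simp only [pow_zero]
    positivity

/-- Termwise differentiation: the factor k cancels one factor of k!, and the index shift raises the
argument of Γ by one. -/
theorem hasDerivAt_besselSeries {ν : ℝ} (hν : 0 ≤ ν) (t : ℝ) :
    HasDerivAt (besselSeries ν) (besselSeries (ν + 1) t) t := by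
  -- Any radius above |t| would do: the differentiated terms need a uniform majorant on an open
  -- interval around t.
  set R := |t| + 1
  have hR : 0 ≤ R := by positivity
  have hu : Summable fun k : ℕ => 2 * ((k : ℝ) * R ^ (k - 1) / k.factorial) := by
    refine Summable.mul_left 2 ((summable_nat_add_iff 1).1 ?_)
    refine (Real.summable_pow_div_factorial R).congr fun k => ?_
    rw [Nat.factorial_succ, Nat.add_sub_cancel]
    push_cast
    field_simp
  have key := hasDerivAt_tsum_of_isPreconnected (𝕜 := ℝ) (F := ℝ) (t := Ioo (-R) R) (y₀ := t)
    (y := t)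
    (g := fun (k : ℕ) y => y ^ k / ((k.factorial : ℝ) * Real.Gamma ((k : ℝ) + ν + 1)))
    (g' := fun (k : ℕ) y => ((k : ℝ) * y ^ (k - 1)) /
      ((k.factorial : ℝ) * Real.Gamma ((k : ℝ) + ν + 1)))
    hu isOpen_Ioo isPreconnected_Ioo (fun k y _ => (hasDerivAt_pow k y).div_const _) ?_ ?_
    (summable_besselSeries hν t) ?_
  · have hs : Summable fun k : ℕ => ((k : ℝ) * t ^ (k - 1)) /
        ((k.factorial : ℝ) * Real.Gamma ((k : ℝ) + ν + 1)) := by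
      refine (summable_nat_add_iff 1).1 ((summable_besselSeries (ν := ν + 1) (by linarith) t).congr
        fun k => ?_)
      rw [Nat.factorial_succ, Nat.add_sub_cancel]
      push_cast
      rw [show (k : ℝ) + 1 + ν + 1 = k + (ν + 1) + 1 by ring, mul_assoc,
        mul_div_mul_left _ _ (by positivity)]
    refine key.congr_deriv ?_
    rw [hs.tsum_eq_zero_add, besselSeries]
    simp only [Nat.cast_zero, zero_mul, zero_div, zero_add]
    refine tsum_congr fun k => ?_
    rw [Nat.factorial_succ, Nat.add_sub_cancel]
    push_cast
    rw [show (k : ℝ) + 1 + ν + 1 = k + (ν + 1) + 1 by ring, mul_assoc,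
      mul_div_mul_left _ _ (by positivity)]
  · intro k y hy
    have hG := half_le_Gamma_index hν k
    have hk : (0 : ℝ) < k.factorial := by positivity
    have hy' : |y| ^ (k - 1) ≤ R ^ (k - 1) :=
      pow_le_pow_left₀ (abs_nonneg y) (abs_lt.2 ⟨hy.1, hy.2⟩).le _
    rw [norm_div, norm_mul, norm_mul, norm_pow, Real.norm_eq_abs y, Real.norm_of_nonneg hk.le,
      Real.norm_of_nonneg (show 0 ≤ Real.Gamma ((k : ℝ) + ν + 1) by linarith), Real.norm_natCast,
      ← mul_div_assoc, div_le_div_iff₀ (by positivity) hk]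
    have h1 : (k : ℝ) * |y| ^ (k - 1) * k.factorial ≤ k * R ^ (k - 1) * k.factorial := by gcongr
    have h2 : 0 ≤ (k : ℝ) * R ^ (k - 1) * k.factorial := by positivity
    nlinarith
  · exact ⟨by linarith [neg_abs_le t], by linarith [le_abs_self t]⟩
  · exact ⟨by linarith [neg_abs_le t], by linarith [le_abs_self t]⟩

theorem continuous_besselSeries {ν : ℝ} (hν : 0 ≤ ν) : Continuous (besselSeries ν) :=
  continuous_iff_continuousAt.2 fun t => (hasDerivAt_besselSeries hν t).continuousAt

theorem contDiff_besselSeries {ν : ℝ} (hν : 0 ≤ ν) : ContDiff ℝ ∞ (besselSeries ν) := by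
  rw [contDiff_infty]
  intro n
  induction n generalizing ν with
  | zero => exact contDiff_zero.2 (continuous_besselSeries hν)
  | succ n ih =>
    have e : deriv (besselSeries ν) = besselSeries (ν + 1) :=
      funext fun t => (hasDerivAt_besselSeries hν t).deriv
    push_cast
    rw [contDiff_succ_iff_deriv, e]
    exact ⟨fun t => (hasDerivAt_besselSeries hν t).differentiableAt, by simp, ih (by linarith)⟩

/-- Compare coefficients: Γ(k+ν+2) = (k+ν+1) Γ(k+ν+1), and k+ν+1 splits as (ν+1) + k. The part with
k is the shifted series of order ν+2. -/
theorem besselSeries_recurrence {ν : ℝ} (hν : 0 ≤ ν) (t : ℝ) :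
    besselSeries ν t = (ν + 1) * besselSeries (ν + 1) t + t * besselSeries (ν + 2) t := by
  have s1 := summable_besselSeries (ν := ν + 1) (by linarith) t
  have s2 := summable_besselSeries (ν := ν + 2) (by linarith) t
  have s3 : Summable fun k : ℕ => (k : ℝ) * t ^ k /
      ((k.factorial : ℝ) * Real.Gamma ((k : ℝ) + (ν + 1) + 1)) := by
    refine (summable_nat_add_iff 1).1 ((s2.mul_left t).congr fun k => ?_)
    rw [Nat.factorial_succ]
    push_cast
    rw [show (k : ℝ) + 1 + (ν + 1) + 1 = k + (ν + 2) + 1 by ring, mul_assoc ((k : ℝ) + 1),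
      mul_div_mul_left _ _ (by positivity), pow_succ']
    ring
  have e3 : t * besselSeries (ν + 2) t = ∑' k : ℕ, (k : ℝ) * t ^ k /
      ((k.factorial : ℝ) * Real.Gamma ((k : ℝ) + (ν + 1) + 1)) := by
    rw [s3.tsum_eq_zero_add, besselSeries, ← tsum_mul_left]
    simp only [Nat.cast_zero, zero_mul, zero_div, zero_add]
    refine tsum_congr fun k => ?_
    rw [Nat.factorial_succ]
    push_cast
    rw [show (k : ℝ) + 1 + (ν + 1) + 1 = k + (ν + 2) + 1 by ring, mul_assoc ((k : ℝ) + 1),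
      mul_div_mul_left _ _ (by positivity), pow_succ']
    ring
  rw [e3, besselSeries, besselSeries, ← tsum_mul_left, ← (s1.mul_left (ν + 1)).tsum_add s3]
  refine tsum_congr fun k => ?_
  have hp : (0 : ℝ) < k + ν + 1 := by positivity
  have hG : 0 < Real.Gamma ((k : ℝ) + ν + 1) := Real.Gamma_pos_of_pos hp
  rw [show (k : ℝ) + (ν + 1) + 1 = (k + ν + 1) + 1 by ring, Real.Gamma_add_one hp.ne']
  field_simp
  ring

theorem continuousOn_besselSeries_order (t : ℝ) :
    ContinuousOn (fun ν => besselSeries ν t) (Ici 0) := by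
  refine continuousOn_tsum (fun k => ?_) ((Real.summable_pow_div_factorial |t|).mul_left 2)
    fun k ν hν => norm_besselSeries_term_le hν t k
  refine continuousOn_const.div (continuousOn_const.mul fun ν hν => ?_) fun ν hν => ?_
  · have h : ContinuousAt Real.Gamma ((k : ℝ) + ν + 1) :=
      (Real.differentiableAt_Gamma fun m => by
        have := mem_Ici.1 hν
        have : (0 : ℝ) < k + ν + 1 := by positivity
        have : (0 : ℝ) ≤ m := Nat.cast_nonneg m
        linarith).continuousAt
    exact (h.comp (f := fun ν : ℝ => (k : ℝ) + ν + 1) (by fun_prop)).continuousWithinAt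
  · have := half_le_Gamma_index hν k
    positivity

/-- The logarithmic derivative `ν + 2 t F_ν'(t) / F_ν(t)`. -/
noncomputable def logDerivSeries (ν t : ℝ) : ℝ :=
  ν + 2 * t * besselSeries (ν + 1) t / besselSeries ν t

theorem besselJ_eq {ν x : ℝ} (hx : 0 < x) :
    besselJ ν x = (x / 2) ^ ν * besselSeries ν (-(x ^ 2 / 4)) := by
  rw [besselJ, besselSeries, ← tsum_mul_left]
  refine tsum_congr fun k => ?_
  rw [Real.rpow_add (by positivity), show (2 * (k : ℝ)) = ((2 * k : ℕ) : ℝ) by push_cast; ring,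
    Real.rpow_natCast, neg_pow (x ^ 2 / 4) k, pow_mul, show (x / 2) ^ 2 = x ^ 2 / 4 by ring]
  ring

theorem besselI_eq {ν x : ℝ} (hx : 0 < x) :
    besselI ν x = (x / 2) ^ ν * besselSeries ν (x ^ 2 / 4) := by
  rw [besselI, besselSeries, ← tsum_mul_left]
  refine tsum_congr fun k => ?_
  rw [Real.rpow_add (by positivity), show (2 * (k : ℝ)) = ((2 * k : ℕ) : ℝ) by push_cast; ring,
    Real.rpow_natCast, pow_mul, show (x / 2) ^ 2 = x ^ 2 / 4 by ring]
  ring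

theorem besselJ_eq_zero_iff {ν x : ℝ} (hx : 0 < x) :
    besselJ ν x = 0 ↔ besselSeries ν (-(x ^ 2 / 4)) = 0 := by
  rw [besselJ_eq hx, mul_eq_zero, or_iff_right (by positivity)]

/-- The sign c = 1 serves I_ν and c = -1 serves J_ν. The power contributes ν and the chain rule
contributes 2t F_ν'/F_ν. -/
theorem logDeriv_rpow_mul_besselSeries {ν z c : ℝ} {f : ℝ → ℝ} (hν : 0 ≤ ν) (hz : 0 < z)
    (hf : ∀ x, 0 < x → f x = (x / 2) ^ ν * besselSeries ν (c * (x ^ 2 / 4)))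
    (h : besselSeries ν (c * (z ^ 2 / 4)) ≠ 0) :
    z * deriv f z / f z = logDerivSeries ν (c * (z ^ 2 / 4)) := by
  have h1 : HasDerivAt (fun x : ℝ => (x / 2) ^ ν) (1 / 2 * ν * (z / 2) ^ (ν - 1)) z :=
    ((hasDerivAt_id z).div_const 2).rpow_const (Or.inl (by positivity))
  have h2 : HasDerivAt (fun x : ℝ => besselSeries ν (c * (x ^ 2 / 4)))
      (besselSeries (ν + 1) (c * (z ^ 2 / 4)) * (c * (2 * z / 4))) z := by
    refine (hasDerivAt_besselSeries hν _).comp z ?_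
    simpa using (((hasDerivAt_pow 2 z).div_const 4).const_mul c)
  have e : deriv f z = _ := ((h1.mul h2).congr_of_eventuallyEq
    (by filter_upwards [Ioi_mem_nhds hz] with x hx using hf x hx)).deriv
  have hp : (0 : ℝ) < (z / 2) ^ ν := by positivity
  rw [e, hf z hz, Real.rpow_sub_one (by positivity), logDerivSeries]
  generalize besselSeries (ν + 1) (c * (z ^ 2 / 4)) = B
  generalize besselSeries ν (c * (z ^ 2 / 4)) = D at h ⊢
  field_simp

theorem logDerivI_eq {ν z : ℝ} (hν : 0 ≤ ν) (hz : 0 < z) :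
    logDerivI ν z = logDerivSeries ν (z ^ 2 / 4) := by
  have h := logDeriv_rpow_mul_besselSeries (c := 1) (f := besselI ν) hν hz
    (fun x hx => by rw [besselI_eq hx, one_mul])
    (by rw [one_mul]; exact (besselSeries_pos hν (by positivity)).ne')
  rwa [one_mul] at h

theorem logDerivJ_eq {ν z : ℝ} (hν : 0 ≤ ν) (hz : 0 < z)
    (h : besselSeries ν (-(z ^ 2 / 4)) ≠ 0) :
    logDerivJ ν z = logDerivSeries ν (-(z ^ 2 / 4)) := by
  have h := logDeriv_rpow_mul_besselSeries (c := -1) (f := besselJ ν) hν hz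
    (fun x hx => by rw [besselJ_eq hx, neg_one_mul]) (by rwa [neg_one_mul])
  rwa [neg_one_mul] at h

theorem sigmaCurve_eq {Λ : ℝ} {m : ℕ} (h : besselSeries m (-Λ / 4) ≠ 0) :
    sigmaCurve Λ m = logDerivSeries m (-Λ / 4) := by
  rw [sigmaCurve]
  split_ifs with h1 h2
  · rw [logDerivI_eq (Nat.cast_nonneg m) (Real.sqrt_pos.2 (by linarith)),
      Real.sq_sqrt (by linarith)]
  · simp [h2, logDerivSeries]
  · have hΛ : 0 < Λ := lt_of_le_of_ne (not_lt.1 h1) (Ne.symm h2)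
    have e : -((√Λ) ^ 2 / 4) = -Λ / 4 := by rw [Real.sq_sqrt hΛ.le]; ring
    rw [logDerivJ_eq (Nat.cast_nonneg m) (Real.sqrt_pos.2 hΛ) (by rwa [e]), e]

/-! ### The Wronskian identity -/

/-- The numerator `ν F_ν(t) + 2 t F_ν'(t)` of the logarithmic derivative. -/
noncomputable def radialDeriv (ν t : ℝ) : ℝ :=
  ν * besselSeries ν t + 2 * t * besselSeries (ν + 1) t

theorem logDerivSeries_mul {ν t : ℝ} (h : besselSeries ν t ≠ 0) :
    logDerivSeries ν t * besselSeries ν t = radialDeriv ν t := by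
  rw [logDerivSeries, radialDeriv]
  field_simp

/-- Bessel's equation in first-order form: the recurrence eliminates F_{ν+2}. -/
theorem hasDerivAt_radialDeriv {ν : ℝ} (hν : 0 ≤ ν) (t : ℝ) :
    HasDerivAt (radialDeriv ν) (2 * besselSeries ν t - ν * besselSeries (ν + 1) t) t := by
  have h1 := (hasDerivAt_besselSeries hν t).const_mul ν
  have h2 := ((hasDerivAt_id t).const_mul 2).mul
    (hasDerivAt_besselSeries (ν := ν + 1) (by linarith) t)
  refine (h1.add h2).congr_deriv ?_
  rw [besselSeries_recurrence hν t, show ν + 1 + 1 = ν + 2 by ring]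
  simp only [id]
  ring

/-- The weighted product of two solutions, integrated over the radius (in the variable `s = r²`). -/
noncomputable def orderIntegral (c ν μ : ℝ) : ℝ :=
  ∫ s in (0 : ℝ)..1, s ^ ((ν + μ) / 2 - 1) * (besselSeries ν (c * s) * besselSeries μ (c * s))

theorem intervalIntegrable_orderIntegral {c ν μ : ℝ} (hν : 0 ≤ ν) (hμ : 0 ≤ μ) (h : 0 < ν + μ) :
    IntervalIntegrable (fun s : ℝ => s ^ ((ν + μ) / 2 - 1) *
      (besselSeries ν (c * s) * besselSeries μ (c * s))) volume 0 1 := by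
  refine (intervalIntegral.intervalIntegrable_rpow' (by linarith)).mul_continuousOn
    (Continuous.continuousOn ?_)
  have := continuous_besselSeries hν
  have := continuous_besselSeries hμ
  fun_prop

/-- With s = r² and a = (ν+μ)/2, the function s^a (N_ν F_μ - F_ν N_μ)(cs), where N_ν is `radialDeriv
ν`, is r times the Wronskian of r^ν F_ν(c r²) and r^μ F_μ(c r²). In its derivative the spectral
terms cancel and only ν² - μ² survives. Integrate over [0, 1]; the boundary term at 0 vanishes
because a > 0. -/
theorem wronskian_eq {c ν μ : ℝ} (hν : 0 ≤ ν) (hμ : 0 ≤ μ) (h : 0 < ν + μ) :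
    radialDeriv ν c * besselSeries μ c - besselSeries ν c * radialDeriv μ c =
      (ν ^ 2 - μ ^ 2) / 2 * orderIntegral c ν μ := by
  set a := (ν + μ) / 2 with ha
  have ha0 : 0 < a := by positivity
  have hin : ∀ s : ℝ, HasDerivAt (fun s => c * s) c s := fun s => by
    simpa using (hasDerivAt_id s).const_mul c
  have hd : ∀ s : ℝ, 0 < s → HasDerivAt (fun s : ℝ => s ^ a *
      (radialDeriv ν (c * s) * besselSeries μ (c * s) -
        besselSeries ν (c * s) * radialDeriv μ (c * s)))
      ((ν ^ 2 - μ ^ 2) / 2 * (s ^ (a - 1) * (besselSeries ν (c * s) * besselSeries μ (c * s))))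
      s := fun s hs => by
    have hN := (hasDerivAt_radialDeriv hν (c * s)).comp s (hin s)
    have hM := (hasDerivAt_radialDeriv hμ (c * s)).comp s (hin s)
    have hF := (hasDerivAt_besselSeries hν (c * s)).comp s (hin s)
    have hG := (hasDerivAt_besselSeries hμ (c * s)).comp s (hin s)
    refine ((Real.hasDerivAt_rpow_const (Or.inl hs.ne')).mul
      ((hN.mul hG).sub (hF.mul hM))).congr_deriv ?_
    have e : s ^ a = s ^ (a - 1) * s := by
      rw [Real.rpow_sub_one hs.ne']; field_simp
    simp only [Function.comp_apply, Pi.sub_apply, Pi.mul_apply]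
    rw [e, radialDeriv, radialDeriv, ha]
    ring
  have key := intervalIntegral.integral_eq_sub_of_hasDerivAt_of_le zero_le_one
    (f := fun s : ℝ => s ^ a * (radialDeriv ν (c * s) * besselSeries μ (c * s) -
        besselSeries ν (c * s) * radialDeriv μ (c * s))) (Continuous.continuousOn ?_)
    (fun s hs => hd s hs.1) ((intervalIntegrable_orderIntegral hν hμ h).const_mul _)
  · rw [intervalIntegral.integral_const_mul] at key
    simp only [mul_one, Real.one_rpow, one_mul, Real.zero_rpow ha0.ne', zero_mul, sub_zero] at key
    exact key.symm
  · have h1 : ∀ {ν : ℝ}, 0 ≤ ν → Continuous (radialDeriv ν) := fun hν =>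
      continuous_iff_continuousAt.2 fun t => (hasDerivAt_radialDeriv hν t).continuousAt
    have := h1 hν
    have := h1 hμ
    have := continuous_besselSeries hν
    have := continuous_besselSeries hμ
    have := Real.continuous_rpow_const ha0.le
    fun_prop

theorem logDerivSeries_sub {c ν μ : ℝ} (hν : 0 ≤ ν) (hμ : 0 ≤ μ) (h : 0 < ν + μ)
    (h1 : besselSeries ν c ≠ 0) (h2 : besselSeries μ c ≠ 0) :
    logDerivSeries μ c - logDerivSeries ν c =
      (μ ^ 2 - ν ^ 2) / 2 * orderIntegral c ν μ / (besselSeries ν c * besselSeries μ c) := by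
  rw [eq_div_iff (by positivity)]
  linear_combination -(wronskian_eq (c := c) hν hμ h) + besselSeries ν c * logDerivSeries_mul h2
    - besselSeries μ c * logDerivSeries_mul h1

theorem orderIntegral_pos {c ν μ : ℝ} (hν : 0 ≤ ν) (hμ : 0 ≤ μ) (h : 0 < ν + μ)
    (hF : ∀ s ∈ Ioo (0 : ℝ) 1, 0 < besselSeries ν (c * s) * besselSeries μ (c * s)) :
    0 < orderIntegral c ν μ :=
  intervalIntegral.intervalIntegral_pos_of_pos_on (intervalIntegrable_orderIntegral hν hμ h)
    (fun s hs => mul_pos (Real.rpow_pos_of_pos hs.1 _) (hF s hs)) one_pos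

/-! ### Positivity before the first zero -/

/-- Sturm comparison. At the first zero b of F_μ(c·) the derivative is nonpositive, so the left side
of the Wronskian identity at cb is nonnegative. The right side is negative there, since both
functions are positive on (0, b) and ν < μ. -/
theorem besselSeries_pos_of_lt_order {c ν μ : ℝ} (hν : 0 ≤ ν) (hνμ : ν < μ)
    (hF : ∀ s ∈ Icc (0 : ℝ) 1, 0 < besselSeries ν (c * s)) :
    ∀ s ∈ Icc (0 : ℝ) 1, 0 < besselSeries μ (c * s) := by
  by_contra! hcon
  have hμ : 0 ≤ μ := hν.trans hνμ.le
  have hcont : Continuous fun s : ℝ => besselSeries μ (c * s) :=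
    (continuous_besselSeries hμ).comp (continuous_const.mul continuous_id)
  obtain ⟨b, hb, hleast⟩ := (isCompact_Icc.inter_right
    (isClosed_le hcont continuous_const)).exists_isLeast (s := Icc (0 : ℝ) 1 ∩
      {s | besselSeries μ (c * s) ≤ 0}) hcon
  have hpos : ∀ s, 0 ≤ s → s < b → 0 < besselSeries μ (c * s) := fun s h0 hs => by
    by_contra! hle
    exact absurd (hleast ⟨⟨h0, hs.le.trans hb.1.2⟩, hle⟩) (not_le.2 hs)
  have hb0 : 0 < b := by
    refine lt_of_le_of_ne hb.1.1 fun h0 => ?_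
    have h1 : besselSeries μ (c * b) ≤ 0 := hb.2
    rw [← h0, mul_zero] at h1
    exact absurd (besselSeries_pos hμ le_rfl) (not_lt.2 h1)
  have hzero : besselSeries μ (c * b) = 0 := by
    refine le_antisymm hb.2 (ge_of_tendsto (x := 𝓝[<] b)
      (hcont.continuousAt.tendsto.mono_left nhdsWithin_le_nhds) ?_)
    filter_upwards [Ioo_mem_nhdsLT hb0] with s hs using (hpos s hs.1.le hs.2).le
  have hder : HasDerivAt (fun s : ℝ => besselSeries μ (c * s))
      (besselSeries (μ + 1) (c * b) * c) b :=
    (hasDerivAt_besselSeries hμ (c * b)).comp b (by simpa using (hasDerivAt_id b).const_mul c)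
  have hle : besselSeries (μ + 1) (c * b) * c ≤ 0 := by
    refine le_of_tendsto (x := 𝓝[<] b)
      ((hasDerivAt_iff_tendsto_slope.1 hder).mono_left
        (nhdsWithin_mono _ fun s hs => ne_of_lt hs)) ?_
    filter_upwards [Ioo_mem_nhdsLT hb0] with s hs
    rw [slope_def_field, hzero, sub_zero]
    exact div_nonpos_of_nonneg_of_nonpos (hpos s hs.1.le hs.2).le (by linarith [hs.2])
  have hI : 0 < orderIntegral (c * b) ν μ := orderIntegral_pos hν hμ (by linarith) fun s hs => by
    have hbs : b * s < b := by nlinarith [hs.2]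
    have hbs0 : 0 ≤ b * s := (mul_pos hb0 hs.1).le
    rw [mul_assoc]
    exact mul_pos (hF _ ⟨hbs0, hbs.le.trans hb.1.2⟩) (hpos _ hbs0 hbs)
  have hw := wronskian_eq (c := c * b) hν hμ (by linarith)
  have hFb := hF b hb.1
  rw [hzero, mul_zero, zero_sub, radialDeriv, hzero, mul_zero, zero_add] at hw
  have h1 : (ν ^ 2 - μ ^ 2) / 2 * orderIntegral (c * b) ν μ < 0 :=
    mul_neg_of_neg_of_pos (by nlinarith) hI
  have h2 : besselSeries ν (c * b) * (2 * (c * b) * besselSeries (μ + 1) (c * b)) ≤ 0 := by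
    refine mul_nonpos_of_nonneg_of_nonpos hFb.le ?_
    nlinarith
  linarith

theorem logDerivSeries_lt {c ν μ : ℝ} (hν : 0 ≤ ν) (hνμ : ν < μ)
    (hF : ∀ s ∈ Icc (0 : ℝ) 1, 0 < besselSeries ν (c * s)) :
    logDerivSeries ν c < logDerivSeries μ c := by
  have hμ : 0 ≤ μ := hν.trans hνμ.le
  have hG := besselSeries_pos_of_lt_order hν hνμ hF
  have h1 := hF 1 (by simp)
  have h2 := hG 1 (by simp)
  rw [mul_one] at h1 h2
  have hI : 0 < orderIntegral c ν μ := orderIntegral_pos hν hμ (by linarith) fun s hs =>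
    mul_pos (hF s (Ioo_subset_Icc_self hs)) (hG s (Ioo_subset_Icc_self hs))
  rw [← sub_pos, logDerivSeries_sub hν hμ (by linarith) h1.ne' h2.ne']
  have : 0 < μ ^ 2 - ν ^ 2 := by nlinarith
  positivity

theorem strictMonoOn_logDerivI {z : ℝ} (hz : 0 < z) :
    StrictMonoOn (fun ν => logDerivI ν z) (Ici 0) := by
  intro ν hν μ hμ h
  simp only [logDerivI_eq (mem_Ici.1 hν) hz, logDerivI_eq (mem_Ici.1 hμ) hz]
  exact logDerivSeries_lt hν h fun s hs => besselSeries_pos hν (mul_nonneg (by positivity) hs.1)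

/-! ### Differentiability in the order -/

theorem continuousAt_orderIntegral {c ν : ℝ} (hν : 0 < ν) :
    ContinuousAt (fun μ => orderIntegral c ν μ) ν := by
  refine intervalIntegral.continuousAt_of_dominated_interval
    -- For μ > 0 and 0 < s ≤ 1 dropping μ/2 from the exponent only enlarges the power, and ν/2 - 1 >
    -- -1 keeps it integrable.
    (bound := fun s => s ^ (ν / 2 - 1) * (2 * Real.exp |c|) ^ 2) ?_ ?_ ?_ ?_
  · filter_upwards [Ioi_mem_nhds hν] with μ hμ
    have := (intervalIntegrable_orderIntegral (c := c) hν.le hμ.le (add_pos hν hμ)).1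
    rw [uIoc_of_le zero_le_one]
    exact this.aestronglyMeasurable
  · filter_upwards [Ioi_mem_nhds hν] with μ hμ
    refine ae_of_all _ fun s hs => ?_
    rw [uIoc_of_le zero_le_one] at hs
    have hB : ∀ {κ : ℝ}, 0 ≤ κ → |besselSeries κ (c * s)| ≤ 2 * Real.exp |c| := fun hκ => by
      refine (abs_besselSeries_le hκ _).trans ?_
      have : |c * s| ≤ |c| := by
        rw [abs_mul, abs_of_pos hs.1]
        exact mul_le_of_le_one_right (abs_nonneg c) hs.2
      gcongr
    have hr : s ^ ((ν + μ) / 2 - 1) ≤ s ^ (ν / 2 - 1) :=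
      Real.rpow_le_rpow_of_exponent_ge hs.1 hs.2 (by linarith [mem_Ioi.1 hμ])
    rw [norm_mul, norm_mul, Real.norm_eq_abs, Real.norm_eq_abs, Real.norm_eq_abs,
      abs_of_pos (Real.rpow_pos_of_pos hs.1 _), sq]
    have hp : 0 < s ^ (ν / 2 - 1) := Real.rpow_pos_of_pos hs.1 _
    exact mul_le_mul hr (mul_le_mul (hB hν.le) (hB hμ.le) (abs_nonneg _) (by positivity))
      (by positivity) hp.le
  · exact (intervalIntegral.intervalIntegrable_rpow' (by linarith)).mul_const _
  · refine ae_of_all _ fun s hs => ?_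
    rw [uIoc_of_le zero_le_one] at hs
    have h1 : ContinuousAt (fun μ => besselSeries μ (c * s)) ν :=
      (continuousOn_besselSeries_order (c * s)).continuousAt (Ici_mem_nhds hν)
    have h2 : ContinuousAt (fun μ : ℝ => s ^ ((ν + μ) / 2 - 1)) ν :=
      (Real.continuousAt_const_rpow hs.1.ne').comp (f := fun μ : ℝ => (ν + μ) / 2 - 1)
        (by fun_prop)
    exact h2.mul (continuousAt_const.mul h1)

/-- No term of the series is differentiated in ν: the Wronskian identity gives the difference
quotient in closed form, with (μ² - ν²)/(μ - ν) = μ + ν, and this expression is continuous at μ = ν.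
-/
theorem hasDerivAt_logDerivSeries_order {c ν : ℝ} (hν : 0 < ν) (h : besselSeries ν c ≠ 0) :
    HasDerivAt (fun μ => logDerivSeries μ c)
      (ν * orderIntegral c ν ν / (besselSeries ν c * besselSeries ν c)) ν := by
  have hF : ContinuousAt (fun μ => besselSeries μ c) ν :=
    (continuousOn_besselSeries_order c).continuousAt (Ici_mem_nhds hν)
  have hlim : ContinuousAt (fun μ => (ν + μ) / 2 * orderIntegral c ν μ /
      (besselSeries ν c * besselSeries μ c)) ν :=
    ((continuousAt_const.add continuousAt_id).div_const 2 |>.mul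
      (continuousAt_orderIntegral hν)).div (continuousAt_const.mul hF) (mul_ne_zero h h)
  rw [hasDerivAt_iff_tendsto_slope]
  have ht := hlim.tendsto.mono_left (nhdsWithin_le_nhds (s := {ν}ᶜ))
  rw [add_self_div_two] at ht
  refine ht.congr' ?_
  filter_upwards [nhdsWithin_le_nhds (Ioi_mem_nhds hν), nhdsWithin_le_nhds (hF.eventually_ne h),
    self_mem_nhdsWithin] with μ hμ hne hμν
  have hμν : μ - ν ≠ 0 := sub_ne_zero.2 hμν
  rw [slope_def_field, logDerivSeries_sub hν.le (mem_Ioi.1 hμ).le (add_pos hν hμ) h hne]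
  field_simp
  ring

/-- On the diagonal the integrand is a weight times a square. It may vanish inside (0, 1), but not
near s = 1, where F_ν(cs) is close to F_ν(c) ≠ 0. -/
theorem orderIntegral_self_pos {c ν : ℝ} (hν : 0 < ν) (h : besselSeries ν c ≠ 0) :
    0 < orderIntegral c ν ν := by
  have hint := intervalIntegrable_orderIntegral (c := c) hν.le hν.le (add_pos hν hν)
  have hcont : Continuous fun s : ℝ => besselSeries ν (c * s) :=
    (continuous_besselSeries hν.le).comp (continuous_const.mul continuous_id)
  have hne : ∀ᶠ s in 𝓝[<] (1 : ℝ), besselSeries ν (c * s) ≠ 0 ∧ s ∈ Ioo (0 : ℝ) 1 := by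
    refine (((hcont.continuousAt (x := 1)).eventually_ne (by simpa using h)).filter_mono
      nhdsWithin_le_nhds).and (Ioo_mem_nhdsLT one_pos)
  rw [orderIntegral, intervalIntegral.integral_pos_iff_support_of_nonneg_ae' ?_ hint]
  · refine ⟨one_pos, ?_⟩
    obtain ⟨l, hl, hsub⟩ := (mem_nhdsLT_iff_exists_Ioo_subset (a := (1 : ℝ))).1 hne
    refine lt_of_lt_of_le ?_ (measure_mono (s := Ioo l 1) fun s hs => ⟨?_, ?_⟩)
    · rw [Real.volume_Ioo]
      exact ENNReal.ofReal_pos.2 (sub_pos.2 hl)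
    · have := hsub hs
      exact mul_ne_zero (Real.rpow_pos_of_pos this.2.1 _).ne' (mul_ne_zero this.1 this.1)
    · have := hsub hs
      exact ⟨this.2.1, this.2.2.le⟩
  · rw [uIoc_of_le zero_le_one]
    filter_upwards [ae_restrict_mem measurableSet_Ioc] with s hs
    exact mul_nonneg (Real.rpow_nonneg hs.1.le _) (mul_self_nonneg _)

theorem strictMonoOn_logDerivJ {z : ℝ} (hz : 0 < z) {S : Set ℝ} (hS : S ⊆ Ici 0)
    (hconn : S.OrdConnected) (hJ : ∀ ν ∈ S, besselJ ν z ≠ 0) :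
    StrictMonoOn (fun ν => logDerivJ ν z) S := by
  set c := -(z ^ 2 / 4)
  have hne : ∀ ν ∈ S, besselSeries ν c ≠ 0 := fun ν hν h =>
    hJ ν hν ((besselJ_eq_zero_iff hz).2 h)
  refine StrictMonoOn.congr (f₁ := fun ν => logDerivSeries ν c) ?_
    fun ν hν => (logDerivJ_eq (hS hν) hz (hne ν hν)).symm
  refine strictMonoOn_of_deriv_pos hconn.convex ?_ fun ν hν => ?_
  · have h1 : ContinuousOn (fun ν : ℝ => besselSeries (ν + 1) c) S :=
      (continuousOn_besselSeries_order c).comp (f := fun ν : ℝ => ν + 1) (by fun_prop)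
        fun ν hν => mem_Ici.2 (by linarith [mem_Ici.1 (hS hν)])
    exact continuousOn_id.add ((continuousOn_const.mul h1).div
      ((continuousOn_besselSeries_order c).mono hS) hne)
  -- The derivative formula needs ν > 0. The order 0 can only be an endpoint of S, where continuity
  -- suffices.
  · have hpos : 0 < ν := by
      have := interior_mono hS hν
      rwa [interior_Ici, mem_Ioi] at this
    have h := hne ν (interior_subset hν)
    rw [(hasDerivAt_logDerivSeries_order hpos h).deriv]
    exact div_pos (mul_pos hpos (orderIntegral_self_pos hpos h)) (mul_self_pos.2 h)

/-! ### The first zero of `J_n` -/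

theorem hasDerivAt_besselSeries_neg {ν : ℝ} (hν : 0 ≤ ν) (t : ℝ) :
    HasDerivAt (fun t => besselSeries ν (-t)) (-besselSeries (ν + 1) (-t)) t := by
  refine ((hasDerivAt_besselSeries hν (-t)).comp t (hasDerivAt_neg t)).congr_deriv ?_
  ring

/-- The classical identity (x^{n+1} J_{n+1})' = x^{n+1} J_n in the variable t = x²/4. -/
theorem hasDerivAt_pow_mul_besselSeries_neg (n : ℕ) (t : ℝ) :
    HasDerivAt (fun t => t ^ (n + 1) * besselSeries (n + 1) (-t))
      (t ^ n * besselSeries n (-t)) t := by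
  refine ((hasDerivAt_pow (n + 1) t).mul
    (hasDerivAt_besselSeries_neg (ν := n + 1) (by positivity) t)).congr_deriv ?_
  rw [besselSeries_recurrence (ν := n) (by positivity), show (n : ℝ) + 1 + 1 = n + 2 by ring]
  push_cast
  ring

/-- Order 0: if F_0(-t) stayed positive, t F_1(-t) would increase, so F_1(-t) ≥ C/t for t ≥ 1. Then
F_0(-t) would fall at least as fast as -C log t. From n to n+1: if F_{n+1}(-t) stayed positive,
F_n(-t) would decrease strictly and remain below some -δ. Then t^{n+1} F_{n+1}(-t) would fall at
least linearly. -/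
theorem exists_besselSeries_neg_nonpos (n : ℕ) : ∃ t : ℝ, 0 < t ∧ besselSeries n (-t) ≤ 0 := by
  induction n with
  | zero =>
    by_contra! hcon
    have hmono : StrictMonoOn (fun t : ℝ => t ^ (0 + 1) * besselSeries (((0 : ℕ) : ℝ) + 1) (-t))
        (Ici 0) := by
      refine strictMonoOn_of_deriv_pos (convex_Ici 0) (fun t _ =>
        (hasDerivAt_pow_mul_besselSeries_neg 0 t).continuousAt.continuousWithinAt) fun t ht => ?_
      rw [interior_Ici] at ht
      rw [(hasDerivAt_pow_mul_besselSeries_neg 0 t).deriv, pow_zero, one_mul]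
      exact hcon t ht
    set C := besselSeries (((0 : ℕ) : ℝ) + 1) (-1)
    have hC : 0 < C := by
      have := hmono (mem_Ici.2 le_rfl) (mem_Ici.2 zero_le_one) one_pos
      simpa [C] using this
    have hle : ∀ t : ℝ, 1 ≤ t → C / t ≤ besselSeries (((0 : ℕ) : ℝ) + 1) (-t) := fun t ht => by
      have := hmono.monotoneOn (mem_Ici.2 zero_le_one) (mem_Ici.2 (zero_le_one.trans ht)) ht
      rw [div_le_iff₀ (by linarith)]
      rw [mul_comm]
      simpa [C] using this
    have hanti : AntitoneOn (fun t => besselSeries ((0 : ℕ) : ℝ) (-t) + C * Real.log t)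
        (Ici 1) := by
      have hd : ∀ t : ℝ, 1 ≤ t →
          HasDerivAt (fun t => besselSeries ((0 : ℕ) : ℝ) (-t) + C * Real.log t)
            (-besselSeries (((0 : ℕ) : ℝ) + 1) (-t) + C * t⁻¹) t := fun t ht =>
        (hasDerivAt_besselSeries_neg (by simp) t).add
          ((Real.hasDerivAt_log (by linarith)).const_mul C)
      refine antitoneOn_of_deriv_nonpos (convex_Ici 1)
        (fun t ht => (hd t ht).continuousAt.continuousWithinAt)
        (fun t ht => (hd t (interior_subset ht)).differentiableAt.differentiableWithinAt)
        fun t ht => ?_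
      rw [(hd t (interior_subset ht)).deriv]
      linarith [hle t (interior_subset ht), div_eq_mul_inv C t]
    set D := besselSeries ((0 : ℕ) : ℝ) (-1)
    have hD : 0 < D := hcon 1 one_pos
    -- At t = exp(D/C) the upper bound D - C log t for F_0(-t) reaches 0.
    have h1 : (1 : ℝ) ≤ Real.exp (D / C) := Real.one_le_exp (by positivity)
    have h2 := hanti (mem_Ici.2 le_rfl) (mem_Ici.2 h1) h1
    simp only [Real.log_exp, Real.log_one, mul_zero, add_zero, mul_div_cancel₀ D hC.ne'] at h2
    change besselSeries _ _ + D ≤ D at h2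
    linarith [hcon _ (Real.exp_pos (D / C))]
  | succ n ih =>
    by_contra! hcon
    obtain ⟨t₀, ht₀, hle⟩ := ih
    have hanti : StrictAntiOn (fun t => besselSeries (n : ℝ) (-t)) (Ici 0) := by
      refine strictAntiOn_of_deriv_neg (convex_Ici 0) (fun t _ =>
        (hasDerivAt_besselSeries_neg (Nat.cast_nonneg n) t).continuousAt.continuousWithinAt)
        fun t ht => ?_
      rw [interior_Ici] at ht
      rw [(hasDerivAt_besselSeries_neg (Nat.cast_nonneg n) t).deriv]
      have := hcon t ht
      push_cast at this
      linarith
    -- Beyond t₀ the value of F_n(-t) is strictly negative; moreover t₁ ≥ 1, so t^n ≥ 1 from there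
    -- on.
    set t₁ := t₀ + 1
    set δ := -besselSeries (n : ℝ) (-t₁)
    have hδ : 0 < δ := by
      have := hanti (mem_Ici.2 ht₀.le) (mem_Ici.2 (by positivity)) (lt_add_one t₀)
      simp only at this
      linarith
    have hanti' : AntitoneOn (fun t : ℝ => t ^ (n + 1) * besselSeries ((n : ℝ) + 1) (-t) + δ * t)
        (Ici t₁) := by
      have hd : ∀ t : ℝ, HasDerivAt
          (fun t : ℝ => t ^ (n + 1) * besselSeries ((n : ℝ) + 1) (-t) + δ * t)
          (t ^ n * besselSeries n (-t) + δ * 1) t := fun t =>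
        (hasDerivAt_pow_mul_besselSeries_neg n t).add ((hasDerivAt_id t).const_mul δ)
      refine antitoneOn_of_deriv_nonpos (convex_Ici t₁)
        (fun t _ => (hd t).continuousAt.continuousWithinAt)
        (fun t _ => (hd t).differentiableAt.differentiableWithinAt) fun t ht => ?_
      have ht : t₁ ≤ t := interior_subset ht
      have h1 : besselSeries (n : ℝ) (-t) ≤ -δ := by
        rw [neg_neg]
        exact hanti.antitoneOn (mem_Ici.2 (by positivity)) (mem_Ici.2 (by linarith)) ht
      have h2 : (1 : ℝ) ≤ t ^ n := one_le_pow₀ (by linarith)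
      rw [(hd t).deriv]
      nlinarith
    set D := t₁ ^ (n + 1) * besselSeries ((n : ℝ) + 1) (-t₁)
    have hD : 0 < D := by
      have := hcon t₁ (by positivity)
      push_cast at this
      positivity
    -- At t₁ + D/δ the linear upper bound, which starts from D with slope -δ, reaches 0.
    have h1 : t₁ ≤ t₁ + D / δ := by
      have : 0 < D / δ := by positivity
      linarith
    have h2 := hanti' (mem_Ici.2 le_rfl) (mem_Ici.2 h1) h1
    have h3 : 0 < t₁ + D / δ := by positivity
    have h4 := hcon _ h3
    push_cast at h4
    have h5 : 0 < (t₁ + D / δ) ^ (n + 1) * besselSeries ((n : ℝ) + 1) (-(t₁ + D / δ)) := by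
      positivity
    have h6 : δ * (t₁ + D / δ) = δ * t₁ + D := by field_simp
    simp only at h2
    linarith

theorem besselSeries_neg_nonpos_imp_zero (n : ℕ) {t : ℝ} (ht : 0 < t)
    (h : besselSeries n (-t) ≤ 0) : ∃ s, 0 < s ∧ s ≤ t ∧ besselSeries n (-s) = 0 := by
  have hc : Continuous fun s : ℝ => besselSeries n (-s) :=
    (continuous_besselSeries (Nat.cast_nonneg n)).comp continuous_neg
  have h0 : 0 < besselSeries (n : ℝ) (-0) := by
    rw [neg_zero]
    exact besselSeries_pos (Nat.cast_nonneg n) le_rfl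
  obtain ⟨s, hs, hs0⟩ := intermediate_value_Icc' ht.le hc.continuousOn ⟨h, h0.le⟩
  refine ⟨s, lt_of_le_of_ne hs.1 fun e => ?_, hs.2, hs0⟩
  simp only at hs0
  rw [← e] at hs0
  exact h0.ne' hs0

theorem besselJ_two_mul_sqrt_eq_zero_iff {ν s : ℝ} (hs : 0 < s) :
    besselJ ν (2 * √s) = 0 ↔ besselSeries ν (-s) = 0 := by
  rw [besselJ_eq_zero_iff (by positivity), mul_pow, Real.sq_sqrt hs.le]
  norm_num

theorem isLeast_besselJZero (n : ℕ) :
    IsLeast {x : ℝ | 0 < x ∧ besselJ n x = 0} (besselJZero n) := by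
  have hc : Continuous fun s : ℝ => besselSeries n (-s) :=
    (continuous_besselSeries (Nat.cast_nonneg n)).comp continuous_neg
  obtain ⟨t, ht, htn⟩ := exists_besselSeries_neg_nonpos n
  obtain ⟨b, hb, hleast⟩ := (isCompact_Icc.inter_right
    (isClosed_le hc continuous_const)).exists_isLeast (s := Icc (0 : ℝ) t ∩
      {s | besselSeries n (-s) ≤ 0}) ⟨t, ⟨ht.le, le_rfl⟩, htn⟩
  have hb0 : 0 < b := by
    refine lt_of_le_of_ne hb.1.1 fun h0 => ?_
    have h1 : besselSeries n (-b) ≤ 0 := hb.2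
    rw [← h0, neg_zero] at h1
    exact absurd (besselSeries_pos (Nat.cast_nonneg n) le_rfl) (not_lt.2 h1)
  obtain ⟨s, hs, hsb, hs0⟩ := besselSeries_neg_nonpos_imp_zero n hb0 hb.2
  have hsb : s = b := le_antisymm hsb (hleast ⟨⟨hs.le, hsb.trans hb.1.2⟩, hs0.le⟩)
  subst hsb
  have hL : IsLeast {x : ℝ | 0 < x ∧ besselJ n x = 0} (2 * √s) := by
    refine ⟨⟨by positivity, (besselJ_two_mul_sqrt_eq_zero_iff hs).2 hs0⟩, fun x hx => ?_⟩
    have hx0 := (besselJ_eq_zero_iff hx.1).1 hx.2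
    have hsx : s ≤ x ^ 2 / 4 := by
      rcases le_total (x ^ 2 / 4) t with h | h
      · exact hleast ⟨⟨by positivity, h⟩, hx0.le⟩
      · exact hb.1.2.trans h
    have : √s ≤ x / 2 := Real.sqrt_le_iff.2 ⟨by linarith [hx.1], by linarith⟩
    linarith
  rw [besselJZero, hL.csInf_eq]
  exact hL

/-- At nonnegative arguments every term of the series is nonnegative and the first is positive. A
nonpositive value at -Λs/4 < 0 would give a zero -t of F_n with 4t ≤ Λs ≤ Λ, hence a zero 2√t of J_n
below j_{n,1}. -/
theorem besselSeries_pos_of_lt_besselJZero {n : ℕ} {Λ : ℝ} (h : Λ < besselJZero n ^ 2) :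
    ∀ s ∈ Icc (0 : ℝ) 1, 0 < besselSeries n (-Λ / 4 * s) := by
  intro s hs
  by_contra! hcon
  have hneg : -Λ / 4 * s < 0 := by
    by_contra! h0
    exact absurd (besselSeries_pos (Nat.cast_nonneg n) h0) (not_lt.2 hcon)
  have hΛ : 0 < Λ := by nlinarith [hs.1]
  obtain ⟨t, ht, htle, ht0⟩ := besselSeries_neg_nonpos_imp_zero n (t := Λ / 4 * s) (by linarith)
    (by rwa [show -(Λ / 4 * s) = -Λ / 4 * s by ring])
  have h1 := (isLeast_besselJZero n).2
    ⟨by positivity, (besselJ_two_mul_sqrt_eq_zero_iff ht).2 ht0⟩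
  have h2 : besselJZero n ^ 2 ≤ (2 * √t) ^ 2 :=
    pow_le_pow_left₀ (isLeast_besselJZero n).1.1.le h1 2
  rw [mul_pow, Real.sq_sqrt ht.le] at h2
  nlinarith [hs.2]

theorem besselSeries_pos_of_le_order {n m : ℕ} {Λ : ℝ} (h : Λ < besselJZero n ^ 2) (hnm : n ≤ m) :
    ∀ s ∈ Icc (0 : ℝ) 1, 0 < besselSeries m (-Λ / 4 * s) := by
  rcases hnm.eq_or_lt with rfl | hlt
  · exact besselSeries_pos_of_lt_besselJZero h
  · exact besselSeries_pos_of_lt_order (Nat.cast_nonneg n) (Nat.cast_lt.2 hlt)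
      (besselSeries_pos_of_lt_besselJZero h)

theorem besselSeries_ne_zero {n m : ℕ} {Λ : ℝ} (h : Λ < besselJZero n ^ 2) (hnm : n ≤ m) :
    besselSeries m (-Λ / 4) ≠ 0 := by
  have := besselSeries_pos_of_le_order h hnm 1 (by simp)
  rw [mul_one] at this
  exact this.ne'

theorem besselJ_sqrt_ne_zero {n m : ℕ} {Λ : ℝ} (h : Λ < besselJZero n ^ 2) (hnm : n ≤ m)
    (hΛ : 0 < Λ) : besselJ m (√Λ) ≠ 0 := by
  rw [Ne, besselJ_eq_zero_iff (Real.sqrt_pos.2 hΛ), Real.sq_sqrt hΛ.le, ← neg_div]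
  exact besselSeries_ne_zero h hnm

theorem sigmaCurve_lt {n m k : ℕ} {Λ : ℝ} (h : Λ < besselJZero k ^ 2) (hkn : k ≤ n)
    (hnm : n < m) : sigmaCurve Λ n < sigmaCurve Λ m := by
  rw [sigmaCurve_eq (besselSeries_ne_zero h hkn),
    sigmaCurve_eq (besselSeries_ne_zero h (hkn.trans hnm.le))]
  exact logDerivSeries_lt (Nat.cast_nonneg n) (Nat.cast_lt.2 hnm)
    (besselSeries_pos_of_le_order h hkn)

/-! ### Integration over the disk and the circle -/

instance : IsFiniteMeasure diskMeasure :=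
  ⟨by rw [diskMeasure, Measure.restrict_apply_univ]; exact measure_ball_lt_top⟩

instance : IsFiniteMeasure circleMeasure := by
  rw [circleMeasure]
  infer_instance

theorem exists_bound_closedBall {f : ℂ → ℂ} (hf : Continuous f) :
    ∃ C : ℝ, ∀ z ∈ Metric.closedBall (0 : ℂ) 1, ‖f z‖ ≤ C :=
  (isCompact_closedBall (0 : ℂ) 1).exists_bound_of_continuousOn hf.continuousOn

theorem memLp_disk {f : ℂ → ℂ} (hf : Continuous f) (p : ENNReal) : MemLp f p diskMeasure := by
  obtain ⟨C, hC⟩ := exists_bound_closedBall hf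
  refine MemLp.of_bound hf.aestronglyMeasurable C ?_
  filter_upwards [ae_restrict_mem measurableSet_ball] with z hz
    using hC z (Metric.ball_subset_closedBall hz)

theorem memLp_circle {f : ℂ → ℂ} (hf : Continuous f) (p : ENNReal) :
    MemLp f p circleMeasure := by
  obtain ⟨C, hC⟩ := exists_bound_closedBall hf
  rw [circleMeasure, memLp_map_measure_iff hf.aestronglyMeasurable
    (continuous_circleMap 0 1).measurable.aemeasurable]
  exact MemLp.of_bound (hf.comp (continuous_circleMap 0 1)).aestronglyMeasurable C
    (ae_of_all _ fun θ => hC _ (circleMap_mem_closedBall 0 zero_le_one θ))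

theorem integrable_disk {f : ℂ → ℂ} (hf : Continuous f) : Integrable f diskMeasure :=
  memLp_one_iff_integrable.1 (memLp_disk hf 1)

theorem integrable_circle {f : ℂ → ℂ} (hf : Continuous f) : Integrable f circleMeasure :=
  memLp_one_iff_integrable.1 (memLp_circle hf 1)

theorem integral_circleMeasure {f : ℂ → ℂ} (hf : AEStronglyMeasurable f circleMeasure) :
    ∫ z, f z ∂circleMeasure = ∫ θ in (-Real.pi)..Real.pi, f (circleMap 0 1 θ) := by
  rw [intervalIntegral.integral_of_le (by linarith [Real.pi_pos]), circleMeasure,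
    integral_map (continuous_circleMap 0 1).measurable.aemeasurable hf]

theorem integral_circleMeasure_congr {f g : ℂ → ℂ} (hf : Continuous f) (hg : Continuous g)
    (h : ∀ z : ℂ, ‖z‖ = 1 → f z = g z) : ∫ z, f z ∂circleMeasure = ∫ z, g z ∂circleMeasure := by
  rw [integral_circleMeasure hf.aestronglyMeasurable, integral_circleMeasure hg.aestronglyMeasurable]
  refine intervalIntegral.integral_congr fun θ _ => h _ ?_
  simp

/-! ### The divergence theorem on the disk -/

theorem fderiv_apply_eq_pderiv (f : ℂ → ℂ) (z w : ℂ) :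
    fderiv ℝ f z w = (w.re : ℂ) * pderiv 0 f z + (w.im : ℂ) * pderiv 1 f z := by
  have e : w = w.re • (1 : ℂ) + w.im • Complex.I := by
    simp [Complex.re_add_im]
  conv_lhs => rw [e]
  rw [map_add, map_smul, map_smul]
  simp [pderiv]

/-- Polar coordinates on the plane. -/
noncomputable def polarMap (p : ℝ × ℝ) : ℂ :=
  (p.1 : ℂ) * ((Real.cos p.2 : ℂ) + (Real.sin p.2 : ℂ) * Complex.I)

theorem contDiff_polarMap : ContDiff ℝ 1 polarMap := by
  have h1 : ContDiff ℝ 1 fun p : ℝ × ℝ => (p.1 : ℂ) :=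
    Complex.ofRealCLM.contDiff.comp contDiff_fst
  have h2 : ContDiff ℝ 1 fun p : ℝ × ℝ => (Real.cos p.2 : ℂ) :=
    Complex.ofRealCLM.contDiff.comp (Real.contDiff_cos.comp contDiff_snd)
  have h3 : ContDiff ℝ 1 fun p : ℝ × ℝ => (Real.sin p.2 : ℂ) :=
    Complex.ofRealCLM.contDiff.comp (Real.contDiff_sin.comp contDiff_snd)
  exact h1.mul (h2.add (h3.mul contDiff_const))

theorem polarMap_one (θ : ℝ) : polarMap (1, θ) = circleMap 0 1 θ := by
  simp [polarMap, circleMap, Complex.exp_mul_I]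

/-- The closed rectangle differs from the polar chart of the disk by a null set and is the domain
required by the divergence theorem on boxes. -/
theorem integral_diskMeasure_eq_polar (h : ℂ → ℂ) :
    ∫ z, h z ∂diskMeasure =
      ∫ p in Icc ((0 : ℝ), -Real.pi) ((1 : ℝ), Real.pi), p.1 • h (polarMap p) := by
  rw [diskMeasure, ← integral_indicator measurableSet_ball, ← Complex.integral_comp_polarCoord_symm]
  have e : ∀ p : ℝ × ℝ, Complex.polarCoord.symm p = polarMap p := fun p => by
    rw [Complex.polarCoord_symm_apply, polarMap]
  have hmem : ∀ p ∈ polarCoord.target,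
      p.1 • (Metric.ball (0 : ℂ) 1).indicator h (Complex.polarCoord.symm p) =
        (Iio (1 : ℝ) ×ˢ (univ : Set ℝ)).indicator (fun p => p.1 • h (polarMap p)) p := fun p hp => by
    have hp1 : 0 < p.1 := hp.1
    have hn : Complex.polarCoord.symm p ∈ Metric.ball (0 : ℂ) 1 ↔
        p ∈ Iio (1 : ℝ) ×ˢ (univ : Set ℝ) := by
      rw [mem_ball_zero_iff, Complex.norm_polarCoord_symm, abs_of_pos hp1]
      simp
    by_cases hb : p ∈ Iio (1 : ℝ) ×ˢ (univ : Set ℝ)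
    · rw [indicator_of_mem hb, indicator_of_mem (hn.2 hb), e]
    · rw [indicator_of_notMem hb, indicator_of_notMem (mt hn.1 hb), smul_zero]
  rw [setIntegral_congr_fun polarCoord.open_target.measurableSet hmem,
    setIntegral_indicator (measurableSet_Iio.prod MeasurableSet.univ)]
  have hset : polarCoord.target ∩ Iio (1 : ℝ) ×ˢ (univ : Set ℝ) =
      Ioo (0 : ℝ) 1 ×ˢ Ioo (-Real.pi) Real.pi := by
    rw [polarCoord_target, prod_inter_prod, inter_univ, Ioi_inter_Iio]
  rw [hset, ← Icc_prod_Icc, Measure.volume_eq_prod]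
  exact setIntegral_congr_set (Measure.set_prod_ae_eq Ioo_ae_eq_Icc Ioo_ae_eq_Icc)

/-- In polar coordinates, f is r times the radial component and g is the angular component, and ∂_r
f + ∂_θ g is r times the divergence. On the rectangle, the side r = 1 gives the circle, the side r =
0 vanishes by the factor r, and the sides θ = ±π cancel by periodicity. -/
theorem integral_divergence_disk {X Y : ℂ → ℂ} (hX : ContDiff ℝ 1 X) (hY : ContDiff ℝ 1 Y) :
    ∫ z, pderiv 0 X z + pderiv 1 Y z ∂diskMeasure =
      ∫ z, (z.re : ℂ) * X z + (z.im : ℂ) * Y z ∂circleMeasure := by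
  set f : ℝ × ℝ → ℂ := fun p => (p.1 : ℂ) *
    ((Real.cos p.2 : ℂ) * X (polarMap p) + (Real.sin p.2 : ℂ) * Y (polarMap p)) with hf
  set g : ℝ × ℝ → ℂ := fun p =>
    (Real.cos p.2 : ℂ) * Y (polarMap p) - (Real.sin p.2 : ℂ) * X (polarMap p) with hg
  have h1 : ContDiff ℝ 1 fun p : ℝ × ℝ => (p.1 : ℂ) :=
    Complex.ofRealCLM.contDiff.comp contDiff_fst
  have h2 : ContDiff ℝ 1 fun p : ℝ × ℝ => (Real.cos p.2 : ℂ) :=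
    Complex.ofRealCLM.contDiff.comp (Real.contDiff_cos.comp contDiff_snd)
  have h3 : ContDiff ℝ 1 fun p : ℝ × ℝ => (Real.sin p.2 : ℂ) :=
    Complex.ofRealCLM.contDiff.comp (Real.contDiff_sin.comp contDiff_snd)
  have hXP : ContDiff ℝ 1 fun p => X (polarMap p) := hX.comp contDiff_polarMap
  have hYP : ContDiff ℝ 1 fun p => Y (polarMap p) := hY.comp contDiff_polarMap
  have hfC : ContDiff ℝ 1 f := h1.mul ((h2.mul hXP).add (h3.mul hYP))
  have hgC : ContDiff ℝ 1 g := (h2.mul hYP).sub (h3.mul hXP)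
  have hfd : Differentiable ℝ f := hfC.differentiable (by simp)
  have hgd : Differentiable ℝ g := hgC.differentiable (by simp)
  have hdiv : ∀ p : ℝ × ℝ, fderiv ℝ f p (1, 0) + fderiv ℝ g p (0, 1) =
      p.1 • (pderiv 0 X (polarMap p) + pderiv 1 Y (polarMap p)) := by
    rintro ⟨r, θ⟩
    have hcos : HasDerivAt (fun θ : ℝ => (Real.cos θ : ℂ)) (-(Real.sin θ : ℂ)) θ := by
      simpa using (Real.hasDerivAt_cos θ).ofReal_comp
    have hsin : HasDerivAt (fun θ : ℝ => (Real.sin θ : ℂ)) (Real.cos θ : ℂ) θ :=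
      (Real.hasDerivAt_sin θ).ofReal_comp
    have hid : HasDerivAt (fun r : ℝ => (r : ℂ)) 1 r := by
      simpa using (hasDerivAt_id r).ofReal_comp
    have hPr : HasDerivAt (fun r : ℝ => polarMap (r, θ))
        ((Real.cos θ : ℂ) + (Real.sin θ : ℂ) * Complex.I) r := by
      simpa [polarMap] using hid.mul_const ((Real.cos θ : ℂ) + (Real.sin θ : ℂ) * Complex.I)
    have hPθ : HasDerivAt (fun θ : ℝ => polarMap (r, θ))
        ((r : ℂ) * (-(Real.sin θ : ℂ) + (Real.cos θ : ℂ) * Complex.I)) θ :=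
      (hcos.add (hsin.mul_const Complex.I)).const_mul (r : ℂ)
    have hr : ∀ {Z : ℂ → ℂ}, ContDiff ℝ 1 Z → HasDerivAt (fun r : ℝ => Z (polarMap (r, θ)))
        ((Real.cos θ : ℂ) * pderiv 0 Z (polarMap (r, θ)) +
          (Real.sin θ : ℂ) * pderiv 1 Z (polarMap (r, θ))) r := fun {Z} hZ => by
      refine (((hZ.differentiable (by simp) _).hasFDerivAt).comp_hasDerivAt r hPr).congr_deriv ?_
      rw [fderiv_apply_eq_pderiv]
      simp only [Complex.add_re, Complex.add_im, Complex.mul_re, Complex.mul_im, Complex.ofReal_re,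
        Complex.ofReal_im, Complex.I_re, Complex.I_im, mul_zero, mul_one, sub_self, zero_add,
        add_zero]
    have hθ : ∀ {Z : ℂ → ℂ}, ContDiff ℝ 1 Z → HasDerivAt (fun θ : ℝ => Z (polarMap (r, θ)))
        (-(r : ℂ) * (Real.sin θ : ℂ) * pderiv 0 Z (polarMap (r, θ)) +
          (r : ℂ) * (Real.cos θ : ℂ) * pderiv 1 Z (polarMap (r, θ))) θ := fun {Z} hZ => by
      refine (((hZ.differentiable (by simp) _).hasFDerivAt).comp_hasDerivAt θ hPθ).congr_deriv ?_
      rw [fderiv_apply_eq_pderiv]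
      simp only [Complex.add_re, Complex.add_im, Complex.mul_re, Complex.mul_im, Complex.ofReal_re,
        Complex.ofReal_im, Complex.I_re, Complex.I_im, Complex.neg_re, Complex.neg_im, mul_zero,
        mul_one, sub_self, zero_add, add_zero, zero_mul, neg_zero, sub_zero, Complex.ofReal_mul,
        Complex.ofReal_neg]
      ring
    have f1 : HasDerivAt (fun r => f (r, θ)) (fderiv ℝ f (r, θ) (1, 0)) r :=
      HasFDerivAt.comp_hasDerivAt (f := fun r : ℝ => (r, θ)) r (hfd (r, θ)).hasFDerivAt
        ((hasDerivAt_id r).prodMk (hasDerivAt_const r θ))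
    have f2 : HasDerivAt (fun r => f (r, θ)) _ r :=
      hid.mul (((hr hX).const_mul (Real.cos θ : ℂ)).add ((hr hY).const_mul (Real.sin θ : ℂ)))
    have g1 : HasDerivAt (fun θ => g (r, θ)) (fderiv ℝ g (r, θ) (0, 1)) θ :=
      HasFDerivAt.comp_hasDerivAt (f := fun θ : ℝ => (r, θ)) θ (hgd (r, θ)).hasFDerivAt
        ((hasDerivAt_const θ r).prodMk (hasDerivAt_id θ))
    have g2 : HasDerivAt (fun θ => g (r, θ)) _ θ :=
      (hcos.mul (hθ hY)).sub (hsin.mul (hθ hX))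
    have hsq : (Real.sin θ : ℂ) ^ 2 + (Real.cos θ : ℂ) ^ 2 = 1 := by
      exact_mod_cast Real.sin_sq_add_cos_sq θ
    rw [f1.unique f2, g1.unique g2, Complex.real_smul]
    linear_combination ((r : ℂ) * (pderiv 0 X (polarMap (r, θ)) +
      pderiv 1 Y (polarMap (r, θ)))) * hsq
  have hcont : Continuous fun p : ℝ × ℝ => fderiv ℝ f p (1, 0) + fderiv ℝ g p (0, 1) :=
    ((hfC.continuous_fderiv (by simp)).clm_apply continuous_const).add
      ((hgC.continuous_fderiv (by simp)).clm_apply continuous_const)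
  have key := integral_divergence_prod_Icc_of_hasFDerivAt_of_le f g (fderiv ℝ f) (fderiv ℝ g)
    ((0 : ℝ), -Real.pi) ((1 : ℝ), Real.pi) ⟨zero_le_one, by
      show -Real.pi ≤ Real.pi
      linarith [Real.pi_pos]⟩ hfC.continuous.continuousOn
    hgC.continuous.continuousOn (fun p _ => (hfd p).hasFDerivAt) (fun p _ => (hgd p).hasFDerivAt)
    (hcont.continuousOn.integrableOn_compact isCompact_Icc)
  simp only [hdiv] at key
  have hper : ∀ r : ℝ, g (r, Real.pi) = g (r, -Real.pi) := fun r => by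
    simp [hg, polarMap]
  have hzero : ∀ θ : ℝ, f (0, θ) = 0 := fun θ => by simp [hf]
  simp only [hper, hzero, sub_self, zero_add, intervalIntegral.integral_zero, sub_zero] at key
  rw [integral_diskMeasure_eq_polar, key, integral_circleMeasure]
  · refine intervalIntegral.integral_congr fun θ _ => ?_
    simp only [hf, polarMap_one, Complex.ofReal_one, one_mul, circleMap_zero,
      Complex.exp_ofReal_mul_I_re, Complex.exp_ofReal_mul_I_im]
  · have := hX.continuous
    have := hY.continuous
    exact Continuous.aestronglyMeasurable (by fun_prop)

/-! ### Smooth functions in the Sobolev space -/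

theorem pderiv_mul {f g : ℂ → ℂ} {z : ℂ} (hf : DifferentiableAt ℝ f z)
    (hg : DifferentiableAt ℝ g z) (i : Fin 2) :
    pderiv i (fun z => f z * g z) z = pderiv i f z * g z + f z * pderiv i g z := by
  simp only [pderiv, fderiv_fun_mul hf hg, add_apply,
    smul_apply, smul_eq_mul]
  ring

theorem pderiv_const (c : ℂ) (i : Fin 2) (z : ℂ) : pderiv i (fun _ => c) z = 0 := by
  simp [pderiv]

theorem contDiff_pderiv {f : ℂ → ℂ} (hf : ContDiff ℝ ∞ f) (i : Fin 2) :
    ContDiff ℝ ∞ (pderiv i f) :=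
  (hf.fderiv_right (by simp)).clm_apply contDiff_const

theorem integral_pderiv_mul_eq {f φ : ℂ → ℂ} (hf : ContDiff ℝ ∞ f) (hφ : ContDiff ℝ ∞ φ)
    (i : Fin 2) :
    ∫ z, f z * pderiv i φ z ∂diskMeasure =
      (∫ z, ((![z.re, z.im] i : ℝ) : ℂ) * (f z * φ z) ∂circleMeasure) -
        ∫ z, pderiv i f z * φ z ∂diskMeasure := by
  have hfφ : ContDiff ℝ 1 fun z => f z * φ z := (hf.mul hφ).of_le (by simp)
  have hdf : Differentiable ℝ f := hf.differentiable (by simp)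
  have hdφ : Differentiable ℝ φ := hφ.differentiable (by simp)
  have c1 : Continuous fun z => pderiv i f z * φ z := (continuous_pderiv hf i).mul hφ.continuous
  have c2 : Continuous fun z => f z * pderiv i φ z := hf.continuous.mul (continuous_pderiv hφ i)
  rw [eq_sub_iff_add_eq', ← integral_add (integrable_disk c1) (integrable_disk c2)]
  simp only [← fun z => pderiv_mul (hdf z) (hdφ z) i]
  fin_cases i
  · simpa [pderiv_const] using integral_divergence_disk hfφ (contDiff_const (c := (0 : ℂ)))
  · simpa [pderiv_const] using integral_divergence_disk (contDiff_const (c := (0 : ℂ))) hfφ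

theorem IsTestFunction.eq_zero_of_norm_eq_one {φ : ℂ → ℂ} (h : IsTestFunction φ) {z : ℂ}
    (hz : ‖z‖ = 1) : φ z = 0 := by
  by_contra hne
  have := h.support (subset_tsupport φ hne)
  rw [mem_ball_zero_iff, hz] at this
  exact lt_irrefl _ this

theorem isH1_of_contDiff {f : ℂ → ℂ} (hf : ContDiff ℝ ∞ f) : IsH1 f (fun i => pderiv i f) where
  memLp := memLp_disk hf.continuous 2
  memLp_grad i := memLp_disk (continuous_pderiv hf i) 2
  weak φ hφ i := by
    rw [integral_pderiv_mul_eq hf hφ.smooth i, sub_eq_neg_self]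
    have hc : Continuous fun z : ℂ => ((![z.re, z.im] i : ℝ) : ℂ) * (f z * φ z) := by
      have := hf.continuous
      have := hφ.smooth.continuous
      fin_cases i <;> simp <;> fun_prop
    rw [integral_circleMeasure_congr hc continuous_const (g := fun _ => 0) fun z hz => by
      rw [hφ.eq_zero_of_norm_eq_one hz, mul_zero, mul_zero], integral_zero]

theorem hasTrace_of_contDiff {f : ℂ → ℂ} (hf : ContDiff ℝ ∞ f) :
    HasTrace f (fun i => pderiv i f) ((memLp_circle hf.continuous 2).toLp f) := by
  refine ⟨fun _ => f, fun _ => hf, by simp, fun i => by simp, ?_⟩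
  have : eLpNorm (f - ((memLp_circle hf.continuous 2).toLp f : ℂ → ℂ)) 2 circleMeasure = 0 := by
    rw [eLpNorm_congr_ae (g := 0), eLpNorm_zero]
    filter_upwards [(memLp_circle hf.continuous 2).coeFn_toLp] with z hz
    rw [Pi.sub_apply, hz, sub_self, Pi.zero_apply]
  simp only [this, tendsto_const_nhds]

/-- Smooth solutions of `-Δf = Λ f`. -/
def IsClassicalSolution (Λ : ℝ) (f : ℂ → ℂ) : Prop :=
  ∀ z, pderiv 0 (pderiv 0 f) z + pderiv 1 (pderiv 1 f) z = -(Λ : ℂ) * f z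

/-- Green's first formula for smooth functions: the area integrals left after integration by parts
cancel by the equation. -/
theorem energy_eq_integral_circle {Λ : ℝ} {f φ : ℂ → ℂ} (hf : ContDiff ℝ ∞ f)
    (hφ : ContDiff ℝ ∞ φ) (hΔ : IsClassicalSolution Λ f) :
    energy Λ f (fun i => pderiv i f) φ (fun i => pderiv i φ) =
      ∫ z, ((z.re : ℂ) * pderiv 0 f z + (z.im : ℂ) * pderiv 1 f z) * φ z ∂circleMeasure := by
  have cf := continuous_pderiv hf
  have cφ := hφ.continuous
  have cff := fun i => continuous_pderiv (contDiff_pderiv hf i)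
  have key := fun i => integral_pderiv_mul_eq (contDiff_pderiv hf i) hφ i
  have e1 : (Λ : ℂ) * ∫ z, f z * φ z ∂diskMeasure =
      -((∫ z, pderiv 0 (pderiv 0 f) z * φ z ∂diskMeasure) +
        ∫ z, pderiv 1 (pderiv 1 f) z * φ z ∂diskMeasure) := by
    have i0 : Continuous fun z => pderiv 0 (pderiv 0 f) z * φ z := (cff 0 0).mul cφ
    have i1 : Continuous fun z => pderiv 1 (pderiv 1 f) z * φ z := (cff 1 1).mul cφ
    rw [← integral_add (integrable_disk i0) (integrable_disk i1), ← integral_const_mul, ← integral_neg]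
    refine integral_congr_ae (ae_of_all _ fun z => ?_)
    simp only
    linear_combination φ z * hΔ z
  have e2 : ∫ z, ((z.re : ℂ) * pderiv 0 f z + (z.im : ℂ) * pderiv 1 f z) * φ z ∂circleMeasure =
      (∫ z, (z.re : ℂ) * (pderiv 0 f z * φ z) ∂circleMeasure) +
        ∫ z, (z.im : ℂ) * (pderiv 1 f z * φ z) ∂circleMeasure := by
    have c0 := cf 0
    have c1 := cf 1
    rw [← integral_add (integrable_circle (by fun_prop)) (integrable_circle (by fun_prop))]
    congr 1
    funext z
    ring
  have k0 := key 0
  have k1 := key 1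
  simp only [Matrix.cons_val_zero, Matrix.cons_val_one] at k0 k1
  rw [energy, Fin.sum_univ_two, k0, k1, e1, e2]
  ring

/-! ### Passing to the limit in bilinear expressions -/

theorem tendsto_integral_mul {μ : Measure ℂ} {f : ℂ → ℂ} {g : ℕ → ℂ → ℂ} {g' : ℂ → ℂ}
    (hf : MemLp f 2 μ) (hg : ∀ k, MemLp (g k) 2 μ) (hg' : MemLp g' 2 μ)
    (h : Tendsto (fun k => eLpNorm (g k - g') 2 μ) atTop (𝓝 0)) :
    Tendsto (fun k => ∫ z, f z * g k z ∂μ) atTop (𝓝 (∫ z, f z * g' z ∂μ)) := by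
  refine tendsto_integral_of_L1' _ (hf.integrable_mul hg').1
    (Eventually.of_forall fun k => hf.integrable_mul (hg k)) ?_
  refine tendsto_of_tendsto_of_tendsto_of_le_of_le (h := fun k => eLpNorm f 2 μ *
    eLpNorm (g k - g') 2 μ) tendsto_const_nhds ?_ (fun _ => zero_le) fun k => ?_
  · simpa using ENNReal.Tendsto.const_mul h (Or.inr hf.2.ne)
  · have e : (fun z => f z * g k z) - f * g' = f • (g k - g') := by
      funext z
      simp [mul_sub]
    rw [e]
    exact eLpNorm_smul_le_mul_eLpNorm ((hg k).sub hg').1 hf.1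

/-- A function with a trace comes with smooth approximations. Green's formula holds for each of
them, and both sides converge by Cauchy–Schwarz. -/
theorem hasNormalDeriv_of_contDiff {Λ : ℝ} {f g : ℂ → ℂ} (hf : ContDiff ℝ ∞ f)
    (hΔ : IsClassicalSolution Λ f) (hg : Continuous g)
    (hn : ∀ z : ℂ, ‖z‖ = 1 → (z.re : ℂ) * pderiv 0 f z + (z.im : ℂ) * pderiv 1 f z = g z) :
    HasNormalDeriv Λ f (fun i => pderiv i f) ((memLp_circle hg 2).toLp g) := by
  rintro V H v hV ⟨φ, hφ, h1, h2, h3⟩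
  have hfp := isH1_of_contDiff hf
  have hlim : Tendsto (fun k => energy Λ f (fun i => pderiv i f) (φ k) (fun i => pderiv i (φ k)))
      atTop (𝓝 (energy Λ f (fun i => pderiv i f) V H)) := by
    refine Tendsto.sub (tendsto_finsetSum _ fun i _ => ?_) (Tendsto.const_mul _ ?_)
    · exact tendsto_integral_mul (hfp.memLp_grad i)
        (fun k => (isH1_of_contDiff (hφ k)).memLp_grad i) (hV.memLp_grad i) (h2 i)
    · exact tendsto_integral_mul hfp.memLp (fun k => (isH1_of_contDiff (hφ k)).memLp) hV.memLp h1
  have hlim' := tendsto_integral_mul (memLp_circle hg 2)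
    (fun k => memLp_circle (hφ k).continuous 2) (Lp.memLp v) h3
  have e : ∀ k, energy Λ f (fun i => pderiv i f) (φ k) (fun i => pderiv i (φ k)) =
      ∫ z, g z * φ k z ∂circleMeasure := fun k => by
    rw [energy_eq_integral_circle hf (hφ k) hΔ]
    have := (hφ k).continuous
    have c0 := continuous_pderiv hf 0
    have c1 := continuous_pderiv hf 1
    exact integral_circleMeasure_congr (by fun_prop) (by fun_prop) fun z hz => by rw [hn z hz]
  simp only [e] at hlim
  rw [tendsto_nhds_unique hlim hlim']
  refine integral_congr_ae ?_
  filter_upwards [(memLp_circle hg 2).coeFn_toLp] with z hz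
  rw [hz]

theorem isHelmholtz_of_contDiff {Λ : ℝ} {f : ℂ → ℂ} (hf : ContDiff ℝ ∞ f)
    (hΔ : IsClassicalSolution Λ f) : IsHelmholtz Λ f (fun i => pderiv i f) := by
  intro φ hφ
  have := hφ.smooth.continuous
  have c0 := continuous_pderiv hf 0
  have c1 := continuous_pderiv hf 1
  rw [energy_eq_integral_circle hf hφ.smooth hΔ,
    integral_circleMeasure_congr (g := fun _ => 0) (by fun_prop) continuous_const fun z hz => by
      rw [hφ.eq_zero_of_norm_eq_one hz, mul_zero], integral_zero]

theorem energy_comm (Λ : ℝ) (U V : ℂ → ℂ) (G H : Fin 2 → ℂ → ℂ) :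
    energy Λ U G V H = energy Λ V H U G := by
  simp only [energy, mul_comm]

/-! ### Separation of variables -/

theorem pderiv_eq_of_hasDerivAt {f : ℂ → ℂ} {z d : ℂ} (i : Fin 2) (hf : DifferentiableAt ℝ f z)
    (h : HasDerivAt (fun s : ℝ => f (z + s * ![1, Complex.I] i)) d 0) : pderiv i f z = d := by
  have h0 : HasDerivAt (fun s : ℝ => z + s * ![1, Complex.I] i) (![1, Complex.I] i) 0 := by
    simpa using ((hasDerivAt_id (0 : ℝ)).ofReal_comp.mul_const (![1, Complex.I] i)).const_add z
  have hf' : HasFDerivAt f (fderiv ℝ f z) (z + ((0 : ℝ) : ℂ) * ![1, Complex.I] i) := by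
    simpa using hf.hasFDerivAt
  exact (hf'.comp_hasDerivAt (f := fun s : ℝ => z + s * ![1, Complex.I] i) 0 h0).unique h

/-- The radial factor `F_ν(c |z|²)`. -/
noncomputable def radialFactor (c ν : ℝ) (z : ℂ) : ℂ :=
  (besselSeries ν (c * (z.re ^ 2 + z.im ^ 2)) : ℝ)

/-- The angular factor: `z` for `b = 1` and its conjugate for `b = -1`, to the power `m`. -/
noncomputable def angularFactor (b : ℝ) (m : ℕ) (z : ℂ) : ℂ :=
  ((z.re : ℂ) + b * z.im * Complex.I) ^ m

theorem contDiff_re : ContDiff ℝ ∞ Complex.re := Complex.reCLM.contDiff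

theorem contDiff_im : ContDiff ℝ ∞ Complex.im := Complex.imCLM.contDiff

theorem contDiff_coord (i : Fin 2) : ContDiff ℝ ∞ fun z : ℂ => ((![z.re, z.im] i : ℝ) : ℂ) := by
  fin_cases i
  · exact Complex.ofRealCLM.contDiff.comp contDiff_re
  · exact Complex.ofRealCLM.contDiff.comp contDiff_im

theorem contDiff_radialFactor {c ν : ℝ} (hν : 0 ≤ ν) : ContDiff ℝ ∞ (radialFactor c ν) :=
  Complex.ofRealCLM.contDiff.comp ((contDiff_besselSeries hν).comp
    (contDiff_const.mul ((contDiff_re.pow 2).add (contDiff_im.pow 2))))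

theorem contDiff_angularFactor (b : ℝ) (m : ℕ) : ContDiff ℝ ∞ (angularFactor b m) :=
  ((contDiff_coord 0).add ((contDiff_const.mul (contDiff_coord 1)).mul contDiff_const)).pow m

theorem pderiv_coord (i : Fin 2) (z : ℂ) :
    pderiv i (fun z : ℂ => ((![z.re, z.im] i : ℝ) : ℂ)) z = 1 := by
  refine pderiv_eq_of_hasDerivAt i ((contDiff_coord i).differentiable (by simp) z) ?_
  fin_cases i
  · simpa using ((hasDerivAt_id (0 : ℝ)).const_add z.re).ofReal_comp
  · simpa using ((hasDerivAt_id (0 : ℝ)).const_add z.im).ofReal_comp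

theorem pderiv_radialFactor {c ν : ℝ} (hν : 0 ≤ ν) (i : Fin 2) (z : ℂ) :
    pderiv i (radialFactor c ν) z =
      2 * c * ((![z.re, z.im] i : ℝ) : ℂ) * radialFactor c (ν + 1) z := by
  refine pderiv_eq_of_hasDerivAt i ((contDiff_radialFactor hν).differentiable (by simp) z) ?_
  have key : ∀ x y : ℝ, HasDerivAt
      (fun s : ℝ => ((besselSeries ν (c * ((x + s) ^ 2 + y ^ 2)) : ℝ) : ℂ))
      ((2 * c * x * besselSeries (ν + 1) (c * (x ^ 2 + y ^ 2)) : ℝ) : ℂ) 0 := fun x y => by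
    refine HasDerivAt.ofReal_comp ?_
    have h : HasDerivAt (fun s : ℝ => c * ((x + s) ^ 2 + y ^ 2)) (c * (2 * x)) 0 := by
      simpa using ((((hasDerivAt_id (0 : ℝ)).const_add x).pow 2).add_const (y ^ 2)).const_mul c
    have h' := (hasDerivAt_besselSeries hν (c * ((x + 0) ^ 2 + y ^ 2))).comp (0 : ℝ) h
    refine h'.congr_deriv ?_
    rw [add_zero]
    ring
  fin_cases i
  · simpa [radialFactor] using key z.re z.im
  · simpa [radialFactor, add_comm] using key z.im z.re

theorem pderiv_angularFactor (b : ℝ) (m : ℕ) (i : Fin 2) (z : ℂ) :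
    pderiv i (angularFactor b m) z =
      m * angularFactor b (m - 1) z * ![1, b * Complex.I] i := by
  refine pderiv_eq_of_hasDerivAt i ((contDiff_angularFactor b m).differentiable (by simp) z) ?_
  have hid : HasDerivAt (fun s : ℝ => (s : ℂ)) 1 0 := by
    simpa using (hasDerivAt_id (0 : ℝ)).ofReal_comp
  have key : ∀ d : ℂ, HasDerivAt
      (fun s : ℝ => ((z.re : ℂ) + b * z.im * Complex.I + s * d) ^ m)
      (m * angularFactor b (m - 1) z * d) 0 := fun d => by
    simpa [angularFactor] using ((hid.mul_const d).const_add
      ((z.re : ℂ) + b * z.im * Complex.I)).fun_pow m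
  fin_cases i
  · refine (key 1).congr_of_eventuallyEq (Eventually.of_forall fun s => ?_)
    simp [angularFactor]
    ring
  · refine (key (b * Complex.I)).congr_of_eventuallyEq (Eventually.of_forall fun s => ?_)
    simp [angularFactor]
    ring

theorem pderiv_radial_mul_angular {c ν b : ℝ} (hν : 0 ≤ ν) (m : ℕ) (i : Fin 2) :
    pderiv i (fun z => radialFactor c ν z * angularFactor b m z) = fun z =>
      2 * c * (((![z.re, z.im] i : ℝ) : ℂ) *
        (radialFactor c (ν + 1) z * angularFactor b m z)) +
      m * ![1, b * Complex.I] i * (radialFactor c ν z * angularFactor b (m - 1) z) := by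
  funext z
  rw [pderiv_mul ((contDiff_radialFactor hν).differentiable (by simp) z)
    ((contDiff_angularFactor b m).differentiable (by simp) z), pderiv_radialFactor hν,
    pderiv_angularFactor]
  ring

theorem pderiv_linear_combination {f g : ℂ → ℂ} (hf : ContDiff ℝ ∞ f) (hg : ContDiff ℝ ∞ g)
    (a b : ℂ) (i : Fin 2) (z : ℂ) :
    pderiv i (fun z => a * f z + b * g z) z = a * pderiv i f z + b * pderiv i g z := by
  have e : (fun z => a * f z + b * g z) = a • f + b • g := by
    funext z
    simp
  have haf : ContDiff ℝ ∞ (a • f) := hf.const_smul a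
  have hbg : ContDiff ℝ ∞ (b • g) := hg.const_smul b
  rw [e, pderiv_add haf hbg, pderiv_smul hf, pderiv_smul hg]
  rfl

theorem contDiff_radial_mul_angular {c ν b : ℝ} (hν : 0 ≤ ν) (m : ℕ) :
    ContDiff ℝ ∞ fun z => radialFactor c ν z * angularFactor b m z :=
  (contDiff_radialFactor hν).mul (contDiff_angularFactor b m)

theorem pderiv_pderiv_radial_mul_angular {c ν b : ℝ} (hν : 0 ≤ ν) (m : ℕ) (i : Fin 2) (z : ℂ) :
    pderiv i (pderiv i (fun z => radialFactor c ν z * angularFactor b m z)) z =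
      2 * c * (radialFactor c (ν + 1) z * angularFactor b m z +
        ((![z.re, z.im] i : ℝ) : ℂ) *
        (2 * c * (((![z.re, z.im] i : ℝ) : ℂ) *
          (radialFactor c (ν + 1 + 1) z * angularFactor b m z)) +
        m * ![1, b * Complex.I] i * (radialFactor c (ν + 1) z * angularFactor b (m - 1) z))) +
      m * ![1, b * Complex.I] i *
        (2 * c * (((![z.re, z.im] i : ℝ) : ℂ) *
          (radialFactor c (ν + 1) z * angularFactor b (m - 1) z)) +
        (m - 1 : ℕ) * ![1, b * Complex.I] i *
          (radialFactor c ν z * angularFactor b (m - 1 - 1) z)) := by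
  have hν1 : 0 ≤ ν + 1 := by linarith
  have h1 := contDiff_radial_mul_angular (c := c) (b := b) hν1 m
  rw [pderiv_radial_mul_angular hν, pderiv_linear_combination ((contDiff_coord i).mul h1)
    (contDiff_radial_mul_angular hν _),
    pderiv_mul ((contDiff_coord i).differentiable (by simp) z) (h1.differentiable (by simp) z),
    pderiv_coord, pderiv_radial_mul_angular hν1, pderiv_radial_mul_angular hν, one_mul]

/-- The factor m makes the truncated exponent m - 1 harmless at m = 0. -/
theorem mul_angularFactor_pred (b : ℝ) (m : ℕ) (z : ℂ) :
    (m : ℂ) * (((z.re : ℂ) + b * z.im * Complex.I) * angularFactor b (m - 1) z) =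
      m * angularFactor b m z := by
  cases m with
  | zero => simp
  | succ m => simp [angularFactor, pow_succ']

/-- The angular factor is harmonic, since 1 + (ib)² = 0, and homogeneous of degree m. So the radial
terms add up to 4c ((m+1) F_{m+1} + c|z|² F_{m+2}), which is 4c F_m by the recurrence. -/
theorem laplacian_radial_mul_angular {c b : ℝ} (hb : b ^ 2 = 1) (m : ℕ) (z : ℂ) :
    pderiv 0 (pderiv 0 (fun z => radialFactor c m z * angularFactor b m z)) z +
      pderiv 1 (pderiv 1 (fun z => radialFactor c m z * angularFactor b m z)) z =
      4 * c * (radialFactor c m z * angularFactor b m z) := by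
  have hν : (0 : ℝ) ≤ m := Nat.cast_nonneg m
  have hb' : (b : ℂ) ^ 2 = 1 := by exact_mod_cast hb
  have hI : Complex.I ^ 2 = -1 := Complex.I_sq
  have hrec : radialFactor c m z = (m + 1) * radialFactor c (m + 1) z +
      c * ((z.re : ℂ) ^ 2 + (z.im : ℂ) ^ 2) * radialFactor c (m + 1 + 1) z := by
    have := besselSeries_recurrence hν (c * (z.re ^ 2 + z.im ^ 2))
    rw [radialFactor, this, radialFactor, radialFactor, show (m : ℝ) + 2 = m + 1 + 1 by ring]
    push_cast
    ring
  have hpred := mul_angularFactor_pred b m z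
  rw [pderiv_pderiv_radial_mul_angular hν, pderiv_pderiv_radial_mul_angular hν]
  simp only [Matrix.cons_val_zero, Matrix.cons_val_one]
  linear_combination 4 * c * radialFactor c (m + 1) z * hpred -
    4 * c * angularFactor b m z * hrec +
    (m : ℂ) * (m - 1 : ℕ) * radialFactor c m z * angularFactor b (m - 1 - 1) z *
      ((b : ℂ) ^ 2 * hI - hb')

theorem radialFactor_of_norm_eq_one (c ν : ℝ) {z : ℂ} (hz : ‖z‖ = 1) :
    radialFactor c ν z = (besselSeries ν c : ℝ) := by
  have : z.re ^ 2 + z.im ^ 2 = 1 := by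
    have := Complex.sq_norm z
    rw [hz, Complex.normSq_apply] at this
    linarith
  rw [radialFactor, this, mul_one]

theorem normal_deriv_radial_mul_angular {c b : ℝ} (m : ℕ) {z : ℂ} (hz : ‖z‖ = 1) :
    (z.re : ℂ) * pderiv 0 (fun z => radialFactor c m z * angularFactor b m z) z +
      (z.im : ℂ) * pderiv 1 (fun z => radialFactor c m z * angularFactor b m z) z =
      (radialDeriv m c : ℝ) * angularFactor b m z := by
  have hν : (0 : ℝ) ≤ m := Nat.cast_nonneg m
  have hn : (z.re : ℂ) ^ 2 + (z.im : ℂ) ^ 2 = 1 := by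
    have := Complex.sq_norm z
    rw [hz, Complex.normSq_apply] at this
    norm_cast
    linarith
  have hpred := mul_angularFactor_pred b m z
  rw [pderiv_radial_mul_angular hν, pderiv_radial_mul_angular hν]
  simp only [Matrix.cons_val_zero, Matrix.cons_val_one, radialFactor_of_norm_eq_one _ _ hz]
  rw [radialDeriv]
  push_cast
  linear_combination (besselSeries m c : ℂ) * hpred +
    2 * c * (besselSeries (m + 1) c : ℂ) * angularFactor b m z * hn

/-! ### The eigenfunctions -/

/-- The function on the plane that equals `e^{inθ}` on the unit circle: `zⁿ` for `n ≥ 0`, and the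
power `-n` of the conjugate of `z` for `n < 0`. -/
noncomputable def circlePow (n : ℤ) : ℂ → ℂ :=
  angularFactor (if 0 ≤ n then 1 else -1) n.natAbs

theorem contDiff_circlePow (n : ℤ) : ContDiff ℝ ∞ (circlePow n) := contDiff_angularFactor _ _

theorem continuous_circlePow (n : ℤ) : Continuous (circlePow n) := (contDiff_circlePow n).continuous

theorem circlePow_circleMap (n : ℤ) (θ : ℝ) :
    circlePow n (circleMap 0 1 θ) = Complex.exp (n * θ * Complex.I) := by
  rw [circlePow, angularFactor, circleMap_zero, Complex.ofReal_one, one_mul,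
    Complex.exp_ofReal_mul_I_re, Complex.exp_ofReal_mul_I_im]
  split_ifs with h
  · have e : (n : ℂ) = (n.natAbs : ℂ) := by
      have h' : ((n.natAbs : ℤ)) = n := by omega
      have h'' : ((n.natAbs : ℤ) : ℂ) = (n : ℂ) := congrArg _ h'
      rw [← h'', Int.cast_natCast]
    rw [e, mul_assoc (n.natAbs : ℂ), Complex.exp_nat_mul, Complex.exp_mul_I]
    push_cast
    ring
  · have e : (n : ℂ) * θ * Complex.I = n.natAbs * ((-θ : ℂ) * Complex.I) := by
      have : (n : ℂ) = -(n.natAbs : ℂ) := by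
        have h' : ((n.natAbs : ℤ)) = -n := by omega
        have h'' : ((n.natAbs : ℤ) : ℂ) = ((-n : ℤ) : ℂ) := congrArg _ h'
        rw [← Int.cast_natCast, h'', Int.cast_neg, neg_neg]
      rw [this]
      ring
    rw [e, Complex.exp_nat_mul, Complex.exp_mul_I, Complex.cos_neg, Complex.sin_neg]
    push_cast
    ring

/-- The function `e^{inθ}` in `L²` of the circle. -/
noncomputable def circleMode (n : ℤ) : L2Circle :=
  (memLp_circle (continuous_circlePow n) 2).toLp (circlePow n)

theorem coeFn_circleMode (n : ℤ) : circleMode n =ᵐ[circleMeasure] circlePow n :=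
  (memLp_circle (continuous_circlePow n) 2).coeFn_toLp

theorem ae_norm_eq_one : ∀ᵐ z ∂circleMeasure, ‖z‖ = 1 := by
  rw [circleMeasure, ae_map_iff (continuous_circleMap 0 1).measurable.aemeasurable
    (measurableSet_eq_fun measurable_norm measurable_const)]
  exact ae_of_all _ fun θ => by simp

/-- The separated solution has trace F_m(c) e^{inθ} and normal derivative N_m(c) e^{inθ}, with N_m =
`radialDeriv m`. Dividing by F_m(c) ≠ 0 gives the eigenvalue L_m(c). -/
theorem isDtN_circleMode {Λ : ℝ} (n : ℤ) (h : besselSeries n.natAbs (-Λ / 4) ≠ 0) :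
    IsDtN Λ (circleMode n) ((sigmaCurve Λ n.natAbs : ℂ) • circleMode n) := by
  set m := n.natAbs with hm
  set c := -Λ / 4
  set b : ℝ := if 0 ≤ n then 1 else -1 with hb
  have hb2 : b ^ 2 = 1 := by
    rw [hb]
    split_ifs <;> norm_num
  set F : ℂ := ((besselSeries m c : ℝ) : ℂ)
  have hF : F ≠ 0 := Complex.ofReal_ne_zero.2 h
  set f₀ : ℂ → ℂ := fun z => radialFactor c m z * angularFactor b m z with hf₀
  have hf₀C : ContDiff ℝ ∞ f₀ := contDiff_radial_mul_angular (Nat.cast_nonneg m) m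
  have hpow : circlePow n = angularFactor b m := rfl
  have hsol : IsClassicalSolution Λ f₀ := fun z => by
    rw [hf₀, laplacian_radial_mul_angular hb2]
    simp only [c]
    push_cast
    ring
  set g₀ : ℂ → ℂ := fun z => (radialDeriv m c : ℝ) * angularFactor b m z
  have hg₀ : Continuous g₀ := continuous_const.mul (contDiff_angularFactor b m).continuous
  have hmain : IsDtN Λ ((memLp_circle hf₀C.continuous 2).toLp f₀)
      ((memLp_circle hg₀ 2).toLp g₀) :=
    ⟨f₀, _, isH1_of_contDiff hf₀C, hasTrace_of_contDiff hf₀C, isHelmholtz_of_contDiff hf₀C hsol,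
      hasNormalDeriv_of_contDiff hf₀C hsol hg₀ fun z hz => normal_deriv_radial_mul_angular m hz⟩
  have e1 : (memLp_circle hf₀C.continuous 2).toLp f₀ = F • circleMode n := by
    refine Lp.ext ?_
    filter_upwards [(memLp_circle hf₀C.continuous 2).coeFn_toLp, Lp.coeFn_smul F (circleMode n),
      coeFn_circleMode n, ae_norm_eq_one] with z h1 h2 h3 h4
    rw [h1, h2, Pi.smul_apply, h3, hpow, hf₀]
    simp only [radialFactor_of_norm_eq_one _ _ h4, smul_eq_mul, F]
  have e2 : (memLp_circle hg₀ 2).toLp g₀ = F • ((sigmaCurve Λ m : ℂ) • circleMode n) := by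
    rw [smul_smul]
    refine Lp.ext ?_
    filter_upwards [(memLp_circle hg₀ 2).coeFn_toLp,
      Lp.coeFn_smul (F * (sigmaCurve Λ m : ℂ)) (circleMode n), coeFn_circleMode n] with z h1 h2 h3
    rw [h1, h2, Pi.smul_apply, h3, hpow, smul_eq_mul, sigmaCurve_eq h]
    simp only [g₀, F, ← logDerivSeries_mul h]
    push_cast
    ring
  have := hmain.smul F⁻¹
  rwa [e1, e2, inv_smul_smul₀ hF, inv_smul_smul₀ hF] at this

/-- Each solution is an admissible test function in the Green formula of the other, and the energy
form is symmetric. -/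
theorem IsDtN.symmetric {Λ : ℝ} {u g u' g' : L2Circle} (h : IsDtN Λ u g) (h' : IsDtN Λ u' g') :
    ∫ z, g z * u' z ∂circleMeasure = ∫ z, g' z * u z ∂circleMeasure := by
  obtain ⟨U, G, a, b, -, d⟩ := h
  obtain ⟨U', G', a', b', -, d'⟩ := h'
  rw [← d U' G' u' a' b', ← d' U G u a b, energy_comm]

/-! ### Fourier series on the circle -/

theorem conj_circlePow (n : ℤ) {z : ℂ} (hz : ‖z‖ = 1) :
    (starRingEnd ℂ) (circlePow n z) = circlePow (-n) z := by
  obtain ⟨θ, rfl⟩ : ∃ θ : ℝ, circleMap 0 1 θ = z :=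
    ⟨z.arg, by rw [circleMap_zero, ← hz, Complex.norm_mul_exp_arg_mul_I]⟩
  rw [circlePow_circleMap, circlePow_circleMap, ← Complex.exp_conj]
  simp

theorem inner_circleMode (n : ℤ) (u : L2Circle) :
    inner ℂ (circleMode n) u = ∫ z, circleMode (-n) z * u z ∂circleMeasure := by
  rw [L2.inner_def]
  refine integral_congr_ae ?_
  filter_upwards [coeFn_circleMode n, coeFn_circleMode (-n), ae_norm_eq_one] with z h1 h2 h3
  rw [h1, h2, RCLike.inner_apply, conj_circlePow n h3, mul_comm]

theorem inner_circleMode_circleMode (n k : ℤ) :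
    inner ℂ (circleMode n) (circleMode k) = if n = k then 2 * (Real.pi : ℂ) else 0 := by
  have e : inner ℂ (circleMode n) (circleMode k) =
      ∫ z, circlePow (-n) z * circlePow k z ∂circleMeasure := by
    rw [inner_circleMode]
    refine integral_congr_ae ?_
    filter_upwards [coeFn_circleMode (-n), coeFn_circleMode k] with z h1 h2
    rw [h1, h2]
  have hc : Continuous fun z => circlePow (-n) z * circlePow k z :=
    (continuous_circlePow _).mul (continuous_circlePow _)
  rw [e, integral_circleMeasure hc.aestronglyMeasurable]
  have e2 : ∀ θ : ℝ, circlePow (-n) (circleMap 0 1 θ) * circlePow k (circleMap 0 1 θ) =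
      Complex.exp (((k - n : ℤ) : ℂ) * Complex.I * θ) := fun θ => by
    rw [circlePow_circleMap, circlePow_circleMap, ← Complex.exp_add]
    push_cast
    ring_nf
  simp only [e2]
  split_ifs with h
  · subst h
    simp
    ring
  · have hd : ((k - n : ℤ) : ℂ) ≠ 0 := Int.cast_ne_zero.2 (sub_ne_zero.2 (Ne.symm h))
    rw [integral_exp_mul_complex (mul_ne_zero hd Complex.I_ne_zero)]
    have : Complex.exp (((k - n : ℤ) : ℂ) * Complex.I * (Real.pi : ℝ)) =
        Complex.exp (((k - n : ℤ) : ℂ) * Complex.I * ((-Real.pi : ℝ) : ℂ)) := by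
      rw [Complex.exp_eq_exp_iff_exists_int]
      exact ⟨k - n, by push_cast; ring⟩
    rw [this, sub_self, zero_div]

instance : Fact (0 < 2 * Real.pi) := ⟨Real.two_pi_pos⟩

/-- The parametrization of the unit circle by `ℝ / 2πℤ`. -/
noncomputable def circleParam (x : AddCircle (2 * Real.pi)) : ℂ := (AddCircle.toCircle x : ℂ)

theorem circleParam_coe (θ : ℝ) : circleParam (θ : AddCircle (2 * Real.pi)) = circleMap 0 1 θ := by
  rw [circleParam, AddCircle.toCircle_apply_mk, Circle.coe_exp, circleMap_zero]
  rw [div_self Real.two_pi_pos.ne', one_mul, Complex.ofReal_one, one_mul]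

theorem continuous_circleParam : Continuous circleParam :=
  continuous_subtype_val.comp AddCircle.continuous_toCircle

theorem measurePreserving_circleParam :
    MeasurePreserving circleParam volume circleMeasure := by
  have h := AddCircle.measurePreserving_mk (2 * Real.pi) (-Real.pi)
  refine ⟨continuous_circleParam.measurable, ?_⟩
  rw [← h.map_eq, Measure.map_map continuous_circleParam.measurable h.measurable, circleMeasure,
    show -Real.pi + 2 * Real.pi = Real.pi by ring]
  congr 1
  funext θ
  exact circleParam_coe θ

theorem integral_circleMeasure_eq_circleParam {f : ℂ → ℂ}
    (hf : AEStronglyMeasurable f circleMeasure) :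
    ∫ z, f z ∂circleMeasure = ∫ x, f (circleParam x) := by
  have h := measurePreserving_circleParam
  rw [← h.map_eq] at hf ⊢
  exact integral_map h.measurable.aemeasurable hf

theorem circlePow_circleParam (n : ℤ) (x : AddCircle (2 * Real.pi)) :
    circlePow n (circleParam x) = fourier n x := by
  induction x using QuotientAddGroup.induction_on with
  | H θ =>
    have h1 : circlePow n (circleParam ((θ : ℝ) : AddCircle (2 * Real.pi))) = _ :=
      congrArg (circlePow n) (circleParam_coe θ)
    have h2 : fourier n ((θ : ℝ) : AddCircle (2 * Real.pi)) = _ := fourier_coe_apply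
    refine h1.trans (Eq.trans ?_ h2.symm)
    rw [circlePow_circleMap]
    congr 1
    have : (Real.pi : ℂ) ≠ 0 := Complex.ofReal_ne_zero.2 Real.pi_ne_zero
    push_cast
    field_simp

/-- Completeness of the exponentials, transported from ℝ/2πℤ by the measure-preserving
parametrization of the circle. -/
theorem eq_zero_of_forall_inner_circleMode {u : L2Circle}
    (h : ∀ n, inner ℂ (circleMode n) u = 0) : u = 0 := by
  have hmp := measurePreserving_circleParam
  have hL : MemLp ((u : ℂ → ℂ) ∘ circleParam) 2 volume := (Lp.memLp u).comp_measurePreserving hmp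
  have hLh : MemLp ((u : ℂ → ℂ) ∘ circleParam) 2 AddCircle.haarAddCircle :=
    memLp_haarAddCircle_iff.2 hL
  have hf : hLh.toLp _ = 0 := by
    rw [← (fourierBasis (T := 2 * Real.pi)).repr.map_eq_zero_iff]
    ext n
    rw [fourierBasis_repr]
    change fourierCoeff _ n = 0
    rw [fourierCoeff, AddCircle.integral_haarAddCircle]
    have hae : (hLh.toLp _ : AddCircle (2 * Real.pi) → ℂ) =ᵐ[volume] u ∘ circleParam := by
      rw [AddCircle.volume_eq_smul_haarAddCircle]
      exact Measure.ae_smul_measure hLh.coeFn_toLp _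
    have e : ∫ x, fourier (-n) x • (hLh.toLp _ : AddCircle (2 * Real.pi) → ℂ) x =
        inner ℂ (circleMode n) u := by
      have hm : AEStronglyMeasurable (fun z => circleMode (-n) z * u z) circleMeasure :=
        (Lp.aestronglyMeasurable _).mul (Lp.aestronglyMeasurable _)
      rw [inner_circleMode, integral_circleMeasure_eq_circleParam hm]
      refine integral_congr_ae ?_
      filter_upwards [hae, hmp.quasiMeasurePreserving.ae_eq_comp (coeFn_circleMode (-n))]
        with x h1 h2
      simp only [Function.comp_apply] at h1 h2
      rw [h1, h2, circlePow_circleParam, smul_eq_mul]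
    rw [e, h n, smul_zero]
  have h0 : (u : ℂ → ℂ) ∘ circleParam =ᵐ[AddCircle.haarAddCircle] 0 :=
    hLh.coeFn_toLp.symm.trans (hf ▸ Lp.coeFn_zero ℂ 2 _)
  have h0' : (u : ℂ → ℂ) ∘ circleParam =ᵐ[volume] 0 := by
    rw [AddCircle.volume_eq_smul_haarAddCircle]
    exact Measure.ae_smul_measure h0 _
  have hn : eLpNorm u 2 circleMeasure = 0 := by
    rw [← eLpNorm_comp_measurePreserving (Lp.aestronglyMeasurable u) hmp, eLpNorm_congr_ae h0',
      eLpNorm_zero]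
  rw [← norm_eq_zero, Lp.norm_def, hn, ENNReal.toReal_zero]

/-! ### The eigenspaces -/

theorem circleMode_mem_dtnEigenspace {Λ : ℝ} (hΛ : Λ < besselJZero 0 ^ 2) (n : ℤ) :
    circleMode n ∈ dtnEigenspace Λ (sigmaCurve Λ n.natAbs) :=
  isDtN_circleMode n (besselSeries_ne_zero (n := 0) (by exact_mod_cast hΛ) (Nat.zero_le _))

/-- Symmetry against the mode -n, which lies on the same curve as n, gives (t - σ_(|n|)) ⟨e^{inθ},
u⟩ = 0. The mode is -n because the form has no conjugation while the inner product does. -/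
theorem inner_circleMode_eq_zero {Λ t : ℝ} (hΛ : Λ < besselJZero 0 ^ 2) {u : L2Circle}
    (hu : u ∈ dtnEigenspace Λ t) {n : ℤ} (hn : sigmaCurve Λ n.natAbs ≠ t) :
    inner ℂ (circleMode n) u = 0 := by
  have h1 : IsDtN Λ u ((t : ℂ) • u) := hu
  have h2 : IsDtN Λ (circleMode (-n)) ((sigmaCurve Λ (-n).natAbs : ℂ) • circleMode (-n)) :=
    circleMode_mem_dtnEigenspace hΛ (-n)
  have key := h1.symmetric h2
  rw [Int.natAbs_neg] at key
  have e1 : ∫ z, ((t : ℂ) • u : L2Circle) z * circleMode (-n) z ∂circleMeasure =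
      t * inner ℂ (circleMode n) u := by
    rw [inner_circleMode, ← integral_const_mul]
    refine integral_congr_ae ?_
    filter_upwards [Lp.coeFn_smul (t : ℂ) u] with z hz
    rw [hz, Pi.smul_apply, smul_eq_mul]
    ring
  have e2 : ∫ z, ((sigmaCurve Λ n.natAbs : ℂ) • circleMode (-n) : L2Circle) z * u z
      ∂circleMeasure = sigmaCurve Λ n.natAbs * inner ℂ (circleMode n) u := by
    rw [inner_circleMode, ← integral_const_mul]
    refine integral_congr_ae ?_
    filter_upwards [Lp.coeFn_smul (sigmaCurve Λ n.natAbs : ℂ) (circleMode (-n))] with z hz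
    rw [hz, Pi.smul_apply, smul_eq_mul]
    ring
  rw [e1, e2, ← sub_eq_zero, ← sub_mul, mul_eq_zero] at key
  refine key.resolve_left ?_
  rw [← Complex.ofReal_sub]
  exact Complex.ofReal_ne_zero.2 (sub_ne_zero.2 hn.symm)

/-- The Fourier coefficients of an element of the eigenspace at the frequencies `n` with
`σ_{(|n|)} = t`. -/
noncomputable def eigenspaceCoeff (Λ t : ℝ) :
    dtnEigenspace Λ t →ₗ[ℂ] ({n : ℤ // sigmaCurve Λ n.natAbs = t} → ℂ) :=
  LinearMap.pi fun n => ((innerSL ℂ (circleMode n.1)).toLinearMap).comp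
    (dtnEigenspace Λ t).subtype

theorem eigenspaceCoeff_apply {Λ t : ℝ} (u : dtnEigenspace Λ t)
    (n : {n : ℤ // sigmaCurve Λ n.natAbs = t}) :
    eigenspaceCoeff Λ t u n = inner ℂ (circleMode n.1) (u : L2Circle) := rfl

theorem eigenspaceCoeff_injective {Λ t : ℝ} (hΛ : Λ < besselJZero 0 ^ 2) :
    Function.Injective (eigenspaceCoeff Λ t) := by
  rw [injective_iff_map_eq_zero]
  intro u hu
  refine Subtype.ext (eq_zero_of_forall_inner_circleMode fun n => ?_)
  by_cases hn : sigmaCurve Λ n.natAbs = t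
  · rw [← eigenspaceCoeff_apply u ⟨n, hn⟩, hu, Pi.zero_apply]
  · exact inner_circleMode_eq_zero hΛ u.2 hn

theorem eigenspaceCoeff_surjective {Λ t : ℝ} (hΛ : Λ < besselJZero 0 ^ 2)
    [Fintype {n : ℤ // sigmaCurve Λ n.natAbs = t}] :
    Function.Surjective (eigenspaceCoeff Λ t) := by
  intro y
  have hmem : ∀ n : {n : ℤ // sigmaCurve Λ n.natAbs = t},
      circleMode n.1 ∈ dtnEigenspace Λ t := fun n => by
    have := circleMode_mem_dtnEigenspace hΛ n.1
    rwa [n.2] at this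
  -- The modes are orthogonal with squared norm 2π, whence the divisor.
  refine ⟨∑ n, (y n / (2 * (Real.pi : ℂ))) • ⟨circleMode n.1, hmem n⟩, ?_⟩
  have hpi : (Real.pi : ℂ) ≠ 0 := Complex.ofReal_ne_zero.2 Real.pi_ne_zero
  funext k
  rw [map_sum, Finset.sum_apply, Finset.sum_eq_single k]
  · rw [map_smul, Pi.smul_apply, eigenspaceCoeff_apply, inner_circleMode_circleMode, if_pos rfl,
      smul_eq_mul]
    field_simp
  · intro n _ hn
    rw [map_smul, Pi.smul_apply, eigenspaceCoeff_apply, inner_circleMode_circleMode,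
      if_neg fun h => hn (Subtype.ext h.symm), smul_zero]
  · exact fun h => absurd (Finset.mem_univ k) h

theorem finite_and_finrank_dtnEigenspace {Λ t : ℝ} (hΛ : Λ < besselJZero 0 ^ 2)
    (hfin : Finite {n : ℤ // sigmaCurve Λ n.natAbs = t}) :
    FiniteDimensional ℂ (dtnEigenspace Λ t) ∧ Module.finrank ℂ (dtnEigenspace Λ t) =
      Nat.card {n : ℤ // sigmaCurve Λ n.natAbs = t} := by
  have := Fintype.ofFinite {n : ℤ // sigmaCurve Λ n.natAbs = t}
  let e := LinearEquiv.ofBijective (eigenspaceCoeff Λ t)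
    ⟨eigenspaceCoeff_injective hΛ, eigenspaceCoeff_surjective hΛ⟩
  refine ⟨e.symm.finiteDimensional, ?_⟩
  rw [e.finrank_eq, Module.finrank_fintype_fun_eq_card, Nat.card_eq_fintype_card]

/-! ### Growth of the eigenvalue curves -/

theorem hasDerivAt_besselSeries_mul {ν : ℝ} (hν : 0 ≤ ν) (c s : ℝ) :
    HasDerivAt (fun s => besselSeries ν (c * s)) (c * besselSeries (ν + 1) (c * s)) s := by
  refine ((hasDerivAt_besselSeries hν (c * s)).comp s
    (by simpa using (hasDerivAt_id s).const_mul c)).congr_deriv ?_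
  ring

theorem besselSeries_le_zero_value {ν c : ℝ} (hν : 0 ≤ ν) (hc : c ≤ 0)
    (hF : ∀ s ∈ Icc (0 : ℝ) 1, 0 < besselSeries (ν + 1) (c * s)) :
    ∀ s ∈ Icc (0 : ℝ) 1, besselSeries ν (c * s) ≤ besselSeries ν 0 := by
  intro s hs
  have hanti : AntitoneOn (fun s => besselSeries ν (c * s)) (Icc 0 1) := by
    refine antitoneOn_of_deriv_nonpos (convex_Icc 0 1)
      (fun s _ => (hasDerivAt_besselSeries_mul hν c s).continuousAt.continuousWithinAt)
      (fun s _ => (hasDerivAt_besselSeries_mul hν c s).differentiableAt.differentiableWithinAt)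
      fun s hs => ?_
    rw [(hasDerivAt_besselSeries_mul hν c s).deriv]
    exact mul_nonpos_of_nonpos_of_nonneg hc (hF s (interior_subset hs)).le
  simpa using hanti (left_mem_Icc.2 zero_le_one) hs hs.1

/-- The second derivative is F_{ν+2} > 0, so F_ν is convex on [c, 0] and lies above its tangent at
0. -/
theorem besselSeries_ge_linear {ν c : ℝ} (hν : 0 ≤ ν) (hc : c ≤ 0)
    (hF : ∀ s ∈ Icc (0 : ℝ) 1, 0 < besselSeries (ν + 1 + 1) (c * s)) :
    besselSeries ν 0 + c * besselSeries (ν + 1) 0 ≤ besselSeries ν c := by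
  have hd : ∀ s : ℝ, HasDerivAt
      (fun s => besselSeries ν (c * s) - c * besselSeries (ν + 1) 0 * s)
      (c * besselSeries (ν + 1) (c * s) - c * besselSeries (ν + 1) 0) s := fun s => by
    refine ((hasDerivAt_besselSeries_mul hν c s).sub
      ((hasDerivAt_id s).const_mul (c * besselSeries (ν + 1) 0))).congr_deriv ?_
    rw [mul_one]
  have hmono : MonotoneOn (fun s => besselSeries ν (c * s) - c * besselSeries (ν + 1) 0 * s)
      (Icc 0 1) := by
    refine monotoneOn_of_deriv_nonneg (convex_Icc 0 1)
      (fun s _ => (hd s).continuousAt.continuousWithinAt)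
      (fun s _ => (hd s).differentiableAt.differentiableWithinAt) fun s hs => ?_
    rw [(hd s).deriv, ← mul_sub]
    exact mul_nonneg_of_nonpos_of_nonpos hc (sub_nonpos.2
      (besselSeries_le_zero_value (by linarith) hc hF s (interior_subset hs)))
  have := hmono (left_mem_Icc.2 zero_le_one) (right_mem_Icc.2 zero_le_one) zero_le_one
  simp only [mul_zero, sub_zero, mul_one] at this
  linarith

/-- If c ≥ 0 the correction to m is nonnegative. If c ≤ 0, the tangent bound and F_m(0) = (m+1)
F_{m+1}(0) give F_m(c) ≥ (m+1+c) F_{m+1}(0) ≥ F_{m+1}(0) ≥ F_{m+1}(c), using m ≥ |c|. So the ratio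
F_{m+1}(c)/F_m(c) is at most 1. -/
theorem le_sigmaCurve {Λ : ℝ} (hΛ : Λ < besselJZero 0 ^ 2) {m : ℕ} (hm : |-Λ / 4| ≤ m) :
    m - 2 * |-Λ / 4| ≤ sigmaCurve Λ m := by
  have hΛ' : Λ < besselJZero ((0 : ℕ) : ℝ) ^ 2 := by exact_mod_cast hΛ
  have hpos : ∀ m : ℕ, ∀ s ∈ Icc (0 : ℝ) 1, 0 < besselSeries m (-Λ / 4 * s) :=
    fun m => besselSeries_pos_of_le_order hΛ' (Nat.zero_le m)
  rw [sigmaCurve_eq (besselSeries_ne_zero hΛ' (Nat.zero_le m)), logDerivSeries]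
  set c := -Λ / 4
  have hFm : 0 < besselSeries m c := by simpa using hpos m 1 (by simp)
  have hFm1 : 0 < besselSeries (m + 1) c := by simpa using hpos (m + 1) 1 (by simp)
  rcases le_total 0 c with hc | hc
  · have : 0 ≤ 2 * c * besselSeries (m + 1) c / besselSeries m c := by positivity
    linarith [abs_nonneg c]
  · rw [abs_of_nonpos hc] at hm ⊢
    have hpos2 : ∀ s ∈ Icc (0 : ℝ) 1, 0 < besselSeries ((m : ℝ) + 1 + 1) (c * s) := fun s hs => by
      exact_mod_cast hpos (m + 1 + 1) s hs
    have hlow := besselSeries_ge_linear (Nat.cast_nonneg m) hc hpos2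
    have hup : besselSeries (m + 1) c ≤ besselSeries (m + 1) 0 := by
      simpa using besselSeries_le_zero_value (ν := m + 1) (by positivity) hc hpos2 1 (by simp)
    have hp : 0 < besselSeries ((m : ℝ) + 1) 0 := besselSeries_pos (by positivity) le_rfl
    have hm0 : besselSeries (m : ℝ) 0 = (m + 1) * besselSeries ((m : ℝ) + 1) 0 := by
      simpa using besselSeries_recurrence (Nat.cast_nonneg m) 0
    have hle : besselSeries (m + 1) c ≤ besselSeries m c := by
      rw [hm0] at hlow
      nlinarith
    have hratio : besselSeries (m + 1) c / besselSeries m c ≤ 1 := (div_le_one hFm).2 hle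
    rw [mul_div_assoc]
    nlinarith

theorem tendsto_sigmaCurve {Λ : ℝ} (hΛ : Λ < besselJZero 0 ^ 2) :
    Tendsto (sigmaCurve Λ) atTop atTop := by
  refine tendsto_atTop_mono' atTop ?_
    (tendsto_atTop_add_const_right atTop (-(2 * |-Λ / 4|)) tendsto_natCast_atTop_atTop)
  filter_upwards [eventually_ge_atTop ⌈|-Λ / 4|⌉₊] with m hm
  exact le_sigmaCurve hΛ (Nat.ceil_le.1 hm)

theorem strictMono_sigmaCurve {Λ : ℝ} (hΛ : Λ < besselJZero 0 ^ 2) :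
    StrictMono (sigmaCurve Λ) := fun n m h =>
  sigmaCurve_lt (k := 0) (by exact_mod_cast hΛ) (Nat.zero_le n) h

/-! ### The ordered sequence of eigenvalues -/

/-- The enumeration `0, 1, -1, 2, -2, …` of the frequencies. -/
def frequency (k : ℕ+) : ℤ :=
  if (k : ℕ) % 2 = 0 then ((k : ℕ) / 2 : ℕ) else -(((k : ℕ) / 2 : ℕ) : ℤ)

theorem natAbs_frequency (k : ℕ+) : (frequency k).natAbs = (k : ℕ) / 2 := by
  rw [frequency]
  split_ifs <;> omega

theorem bijective_frequency : Function.Bijective frequency := by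
  constructor
  · intro j k h
    have hj := j.pos
    have hk := k.pos
    simp only [frequency] at h
    refine PNat.coe_injective ?_
    split_ifs at h <;> omega
  · intro n
    rcases lt_or_ge 0 n with h | h
    · refine ⟨⟨2 * n.natAbs, by omega⟩, ?_⟩
      simp only [frequency, PNat.mk_coe]
      split_ifs <;> omega
    · refine ⟨⟨2 * n.natAbs + 1, by omega⟩, ?_⟩
      simp only [frequency, PNat.mk_coe]
      split_ifs <;> omega

theorem finite_fiber {σ : ℕ+ → ℝ} (h : Tendsto σ atTop atTop) (t : ℝ) : {k | σ k = t}.Finite := by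
  obtain ⟨N, hN⟩ := eventually_atTop.1 (h.eventually_gt_atTop t)
  refine (finite_Iio N).subset fun k hk => ?_
  by_contra hle
  exact absurd (hN k (not_lt.1 hle)) (not_lt.2 (le_of_eq hk))

/-- If σ k < τ k, then τ takes the value σ k only before k, by monotonicity. There σ agrees with τ,
and σ takes the value once more at k, so its finite fiber is strictly larger. -/
theorem not_lt_of_card_fiber_eq {σ τ : ℕ+ → ℝ} (hσ : Tendsto σ atTop atTop) (hτ : Monotone τ)
    (hcard : ∀ t, Nat.card {k // σ k = t} = Nat.card {k // τ k = t}) {k : ℕ+}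
    (hk : ∀ j < k, σ j = τ j) : ¬ σ k < τ k := by
  intro hlt
  have hss : {j | τ j = σ k} ⊂ {j | σ j = σ k} := by
    refine (ssubset_iff_of_subset fun j hj => ?_).2 ⟨k, rfl, hlt.ne'⟩
    have hjk : j < k := by
      by_contra hle
      have h1 := hτ (not_lt.1 hle)
      rw [show τ j = σ k from hj] at h1
      exact absurd hlt (not_lt.2 h1)
    exact (hk j hjk).trans hj
  exact (ncard_lt_ncard hss (finite_fiber hσ _)).ne (hcard (σ k)).symm

theorem eq_of_card_fiber_eq {σ τ : ℕ+ → ℝ} (hσ : Tendsto σ atTop atTop) (hσm : Monotone σ)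
    (hτ : Tendsto τ atTop atTop) (hτm : Monotone τ)
    (hcard : ∀ t, Nat.card {k // σ k = t} = Nat.card {k // τ k = t}) (k : ℕ+) : σ k = τ k := by
  induction k using PNat.strongInductionOn with
  | _ k ih =>
    exact le_antisymm
      (not_lt.1 (not_lt_of_card_fiber_eq hτ hσm (fun t => (hcard t).symm)
        fun j hj => (ih j hj).symm))
      (not_lt.1 (not_lt_of_card_fiber_eq hσ hτm hcard ih))

theorem isEigenvalueSequence_sigmaCurve {Λ : ℝ} (hΛ : Λ < besselJZero 0 ^ 2) :
    IsEigenvalueSequence Λ fun k => sigmaCurve Λ ((k : ℕ) / 2) := by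
  have htend : Tendsto (fun k : ℕ+ => sigmaCurve Λ ((k : ℕ) / 2)) atTop atTop := by
    refine (tendsto_sigmaCurve hΛ).comp (tendsto_atTop.2 fun n => ?_)
    filter_upwards [eventually_ge_atTop (⟨2 * n + 1, by omega⟩ : ℕ+)] with k hk
    have : 2 * n + 1 ≤ (k : ℕ) := hk
    omega
  have hequiv : ∀ t, {k : ℕ+ // sigmaCurve Λ ((k : ℕ) / 2) = t} ≃
      {n : ℤ // sigmaCurve Λ n.natAbs = t} := fun t =>
    (Equiv.ofBijective frequency bijective_frequency).subtypeEquiv fun k => by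
      rw [Equiv.ofBijective_apply, natAbs_frequency]
  have hfin : ∀ t, Finite {n : ℤ // sigmaCurve Λ n.natAbs = t} := fun t =>
    have : Finite {k : ℕ+ // sigmaCurve Λ ((k : ℕ) / 2) = t} := finite_fiber htend t
    Finite.of_equiv _ (hequiv t)
  exact
  { mono := fun j k h => (strictMono_sigmaCurve hΛ).monotone (Nat.div_le_div_right h)
    tendsto := htend
    finite := fun t => (finite_and_finrank_dtnEigenspace hΛ (hfin t)).1
    mult := fun t => by
      rw [(finite_and_finrank_dtnEigenspace hΛ (hfin t)).2]
      exact (Nat.card_congr (hequiv t)).symm }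

theorem isEigenvalueSequence_iff {Λ : ℝ} (hΛ : Λ < besselJZero 0 ^ 2) (σ : ℕ+ → ℝ) :
    IsEigenvalueSequence Λ σ ↔ ∀ k : ℕ+, σ k = sigmaCurve Λ ((k : ℕ) / 2) := by
  have hτ := isEigenvalueSequence_sigmaCurve hΛ
  refine ⟨fun h k => ?_, fun h => ?_⟩
  · exact eq_of_card_fiber_eq h.tendsto h.mono hτ.tendsto hτ.mono
      (fun t => (h.mult t).symm.trans (hτ.mult t)) k
  · rwa [funext h]

end DiskDtN

theorem theoremA1 :
    -- every `J_n` has a first positive zero `j_{n,1}`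
    (∀ n : ℕ, IsLeast {x : ℝ | 0 < x ∧ DiskDtN.besselJ n x = 0} (DiskDtN.besselJZero n)) ∧
    -- two curves `σ_{(n)}` and `σ_{(m)}` are defined and distinct for `Λ < j_{n,1}^2`
    (∀ n m : ℕ, n < m → ∀ Λ : ℝ, Λ < DiskDtN.besselJZero n ^ 2 →
      (0 < Λ → DiskDtN.besselJ n (√Λ) ≠ 0 ∧ DiskDtN.besselJ m (√Λ) ≠ 0) ∧
      DiskDtN.sigmaCurve Λ n ≠ DiskDtN.sigmaCurve Λ m) ∧
    -- the order of the eigenvalues of the Dirichlet-to-Neumann operator for `Λ < j_{0,1}^2`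
    (∀ Λ : ℝ, Λ < DiskDtN.besselJZero 0 ^ 2 → ∀ σ : ℕ+ → ℝ,
      DiskDtN.IsEigenvalueSequence Λ σ ↔
        ∀ k : ℕ+, σ k = DiskDtN.sigmaCurve Λ ((k : ℕ) / 2)) ∧
    -- strict monotonicity in the order
    (∀ z : ℝ, 0 < z → StrictMonoOn (fun ν => DiskDtN.logDerivI ν z) (Set.Ici 0)) ∧
    (∀ z : ℝ, 0 < z → ∀ S : Set ℝ, S ⊆ Set.Ici 0 → S.OrdConnected →
      (∀ ν ∈ S, DiskDtN.besselJ ν z ≠ 0) →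
      StrictMonoOn (fun ν => DiskDtN.logDerivJ ν z) S) :=
  ⟨DiskDtN.isLeast_besselJZero,
    fun _ _ hnm _ hΛ => ⟨fun h0 => ⟨DiskDtN.besselJ_sqrt_ne_zero hΛ le_rfl h0,
      DiskDtN.besselJ_sqrt_ne_zero hΛ hnm.le h0⟩, (DiskDtN.sigmaCurve_lt hΛ le_rfl hnm).ne⟩,
    fun _ hΛ σ => DiskDtN.isEigenvalueSequence_iff hΛ σ,
    fun _ hz => DiskDtN.strictMonoOn_logDerivI hz,
    fun _ hz _ hS hc hJ => DiskDtN.strictMonoOn_logDerivJ hz hS hc hJ⟩
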